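/- **Conventions.** A dominant meromorphic self-map $f$ of $\mathbb P^k$ is written $f=[G_0:\dots:G_k]$ with homogeneous polynomials $G_i$ of the same degree without nontrivial common factor; $F=(G_0,\dots,G_k)$ is a *lifting* of $f$, and $\mathcal I(f)=\{G_0=\dots=G_k=0\}$ is the indeterminacy locus. $f^n$ is the $n$-th iterate as a meromorphic map (its lifting is obtained from $F\circ\dots\circ F$ by removing common factors), and for a hypersurface $\mathcal H$, $f^n(\mathcal H)$ is the closure of $f^n(\mathcal H\setminus\mathcal I(f^n))$. A hypersurface $\mathcal H$ is *degree lowering of height $n$* if $n\ge 1$ is the smallest integer with $f^n(\mathcal H)\subset\mathcal I(f)$. A *primitive system* of $f$ is a finite collection of degree lowering hypersurfaces $\mathcal H_1,\dots,\mathcal H_M$ of pairwise different heights $n_1,\dots,n_M$ such that $\operatorname{codim} f^m(\mathcal H_j)>1$ for $1\le m\le n_j$, and such that for each irreducible degree lowering hypersurface $\mathcal H$, of height $n$ say, there are $0\le m<n$ and $j$ for which $f^m(\mathcal H)$ is a hypersurface contained in $\mathcal H_j$. The map $f$ is *quasi-algebraically stable* (QAS) if there are an integer $n_0\ge1$ and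 a homogeneous polynomial $H\neq0$ such that, for arbitrarily fixed liftings $F_0,\dots,F_{n_0}$ of $f^0=\mathrm{Id},\dots,f^{n_0}$, the recursion $F_n:=\dfrac{F_1\circ F_{n-1}}{H\circ F_{n-n_0-1}}$, $n>n_0$, defines liftings $F_n$ of $f^n$ for all $n$. **Statement.** Let $P,Q_1,Q_2,Q_3,R\in\mathbb C[z,w,t]$ be homogeneous, $\deg P\ge1$, $\deg Q_1=\deg Q_2=\deg Q_3$, $\deg R=\deg P+\deg Q_1$, with $$P(1,1,1)\,Q_j(1,1,1)=R(1,1,1)\ne0,\qquad j=1,2,3,$$ and suppose that $PQ_1-R,\ PQ_2-R,\ PQ_3-R$ have no nontrivial common factor. Put $f:=[PQ_1-R:PQ_2-R:PQ_3-R]$. Assume: 1. for all $(a,b,c)\in\mathbb C^3\setminus\{0\}$ with $a+b+c=0$, every irreducible component of $\{aQ_1+bQ_2+cQ_3=0\}$ is mapped by $f$ onto a curve (if $aQ_1+bQ_2+cQ_3\equiv 0$, this is required of every irreducible curve); 2. every irreducible component of $\{P=0\}$ is mapped by $f^2$ onto a curve; 3. every irreducible curve $\mathcal G$ with $f(\mathcal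 G)=[1:1:1]$ is contained in $\{P=0\}$. Then $f$ is a dominant meromorphic self-map of $\mathbb P^2$, and with $\mathcal H_0:=\{P=0\}$ and $n_0:=1$: (i) $f$ has exactly one primitive system, and it consists of the single hypersurface $\mathcal H_0$, of height $n_0$; (ii) for every irreducible component $\mathcal H$ of $\mathcal H_0$ and every $m=1,\dots,n_0$, $f^m(\mathcal H)\not\subset\mathcal H_0$; (iii) for every irreducible component $\mathcal H$ of $\mathcal H_0$, either $f^m(\mathcal H)\not\subset\mathcal I(f)$ for all $m\ge n_0+1$, or there is $m_0\ge n_0$ such that $f^{m_0+1}(\mathcal H)$ is a hypersurface and $f^m(\mathcal H)\not\subset\mathcal I(f)$ whenever $n_0+1\le m\le m_0$. Moreover, $f$ is QAS. -/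

import Mathlib

open MvPolynomial

namespace QASMap

/-- Complex projective space `ℙ^k`. -/
abbrev PSpace (k : ℕ) : Type := Projectivization ℂ (Fin (k + 1) → ℂ)

/-- Polynomials in the `k + 1` homogeneous coordinates of `ℙ^k`. -/
abbrev Poly (k : ℕ) : Type := MvPolynomial (Fin (k + 1)) ℂ

/-- A `(k + 1)`-tuple of polynomials, that is, a polynomial self-map of `ℂ^{k+1}`. -/
abbrev PolyMap (k : ℕ) : Type := Fin (k + 1) → Poly k

/-! ### Hypersurfaces -/

/-- The zero locus `{G = 0}` in `ℙ^k` of a polynomial `G`; it is only used for homogeneous `G`,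
where the choice of the representative is irrelevant (see `mk_mem_zeroLocus`). -/
def zeroLocus {k : ℕ} (G : Poly k) : Set (PSpace k) :=
  {p | eval p.rep G = 0}

theorem mk_mem_zeroLocus {k : ℕ} {G : Poly k} {e : ℕ} (hG : G.IsHomogeneous e)
    (v : Fin (k + 1) → ℂ) (hv : v ≠ 0) :
    Projectivization.mk ℂ v hv ∈ zeroLocus G ↔ eval v G = 0 := by
  obtain ⟨a, ha⟩ := Projectivization.exists_smul_eq_mk_rep ℂ v hv
  have h : eval ((a : ℂ) • v) G = (a : ℂ) ^ e * eval v G := by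
    rw [eval_eq, eval_eq, Finset.mul_sum]
    refine Finset.sum_congr rfl fun d hd => ?_
    have hd' : ∑ i ∈ d.support, d i = e := by
      have := hG (mem_support_iff.mp hd)
      simpa [Finsupp.weight_apply, Finsupp.sum] using this
    simp only [Pi.smul_apply, smul_eq_mul, mul_pow, Finset.prod_mul_distrib,
      Finset.prod_pow_eq_pow_sum, hd']
    ring
  have h2 : (Projectivization.mk ℂ v hv).rep = (a : ℂ) • v := ha.symm
  change eval (Projectivization.mk ℂ v hv).rep G = 0 ↔ _
  rw [h2, h]
  simp

/-- A (possibly reducible) hypersurface of `ℙ^k`, as a set. -/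
def IsHypersurface {k : ℕ} (V : Set (PSpace k)) : Prop :=
  ∃ (G : Poly k) (e : ℕ), 0 < e ∧ G.IsHomogeneous e ∧ G ≠ 0 ∧ V = zeroLocus G

/-- An irreducible hypersurface of `ℙ^k`. The irreducible components of a hypersurface `V` are
exactly the irreducible hypersurfaces contained in `V`. -/
def IsIrreducibleHypersurface {k : ℕ} (V : Set (PSpace k)) : Prop :=
  ∃ (G : Poly k) (e : ℕ), G.IsHomogeneous e ∧ Irreducible G ∧ V = zeroLocus G

/-- An algebraic subset of `ℙ^k` has codimension `> 1` iff it contains no irreducible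
hypersurface. -/
def CodimGtOne {k : ℕ} (V : Set (PSpace k)) : Prop :=
  ∀ W : Set (PSpace k), IsIrreducibleHypersurface W → ¬ W ⊆ V

/-- Zariski closure in `ℙ^k`. -/
def zariskiClosure {k : ℕ} (S : Set (PSpace k)) : Set (PSpace k) :=
  {p | ∀ (G : Poly k) (e : ℕ), G.IsHomogeneous e → S ⊆ zeroLocus G → p ∈ zeroLocus G}

/-! ### Meromorphic self-maps, images and iterates -/

/-- The components of `F` have no nontrivial common factor. -/
def NoCommonFactor {k : ℕ} (F : PolyMap k) : Prop :=
  ∀ A : Poly k, (∀ i, A ∣ F i) → IsUnit A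

/-- The value `F(x) ∈ ℂ^{k+1}`. -/
noncomputable def evalMap {k : ℕ} (F : PolyMap k) (x : Fin (k + 1) → ℂ) : Fin (k + 1) → ℂ :=
  fun i => eval x (F i)

/-- The indeterminacy locus of the self-map with lifting `F`: the common zeros of the
components. -/
def indeterminacy {k : ℕ} (F : PolyMap k) : Set (PSpace k) :=
  {p | evalMap F p.rep = 0}

/-- For the self-map `f` with lifting `F`: the set `f(V)`, i.e. the closure of
`f(V \ I(f))`. (The image is constructible for algebraic `V`, so that the Zariski closure is also
the closure in the usual topology.) -/
def image {k : ℕ} (F : PolyMap k) (V : Set (PSpace k)) : Set (PSpace k) :=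
  zariskiClosure
    {p | ∃ q ∈ V, ∃ h : evalMap F q.rep ≠ 0, p = Projectivization.mk ℂ (evalMap F q.rep) h}

/-- `F` is a lifting of a dominant meromorphic self-map of `ℙ^k`: its components are homogeneous
of one and the same degree, have no nontrivial common factor, and the image is dense. -/
structure IsDominantSelfMap {k : ℕ} (F : PolyMap k) : Prop where
  homogeneous : ∃ d : ℕ, ∀ i, (F i).IsHomogeneous d
  noCommonFactor : NoCommonFactor F
  dominant : image F Set.univ = Set.univ

/-- Composition `G ∘ F` of a polynomial with a polynomial map. -/
noncomputable def comp {k : ℕ} (G : Poly k) (F : PolyMap k) : Poly k :=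
  bind₁ F G

/-- The `n`-fold composition `F ∘ ⋯ ∘ F` as polynomial maps, common factors not removed. -/
noncomputable def polyIterate {k : ℕ} (F : PolyMap k) : ℕ → PolyMap k
  | 0 => X
  | n + 1 => fun i => comp (F i) (polyIterate F n)

/-- `G` is a lifting of the `n`-th iterate `f^n` of the self-map `f` with lifting `F`: it arises
from `F ∘ ⋯ ∘ F` by removing a common factor, and has no nontrivial common factor left. Such a `G`
is unique up to a nonzero constant. -/
def IsIterateLifting {k : ℕ} (F : PolyMap k) (n : ℕ) (G : PolyMap k) : Prop :=
  NoCommonFactor G ∧ ∃ c : Poly k, c ≠ 0 ∧ ∀ i, polyIterate F n i = c * G i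

/-- The set `f^n(V)`, where `f^n` is the `n`-th iterate of `f` as a meromorphic self-map. -/
def iterImage {k : ℕ} (F : PolyMap k) (n : ℕ) (V : Set (PSpace k)) : Set (PSpace k) :=
  {p | ∃ G : PolyMap k, IsIterateLifting F n G ∧ p ∈ image G V}

/-! ### Quasi-algebraic stability -/

/-- The self-map `f` with lifting `F` is quasi-algebraically stable: there are `n₀ ≥ 1` and a
homogeneous polynomial `H` such that, for arbitrarily fixed liftings `Φ₀, …, Φ_{n₀}` of
`f^0, …, f^{n₀}`, the recursion `Φ_n = (Φ₁ ∘ Φ_{n-1}) / (H ∘ Φ_{n-n₀-1})`, `n > n₀`, defines a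
sequence of liftings of the iterates `f^n`. -/
def IsQAS {k : ℕ} (F : PolyMap k) : Prop :=
  ∃ (n₀ : ℕ) (H : Poly k) (h : ℕ), 1 ≤ n₀ ∧ H ≠ 0 ∧ H.IsHomogeneous h ∧
    ∀ Φ₀ : ℕ → PolyMap k, (∀ n ≤ n₀, IsIterateLifting F n (Φ₀ n)) →
      ∃ Φ : ℕ → PolyMap k, (∀ n ≤ n₀, Φ n = Φ₀ n) ∧
        (∀ n, IsIterateLifting F n (Φ n)) ∧
        ∀ n, n₀ < n → ∀ i, Φ n i * comp H (Φ (n - n₀ - 1)) = comp (Φ 1 i) (Φ (n - 1))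

/-! ### Degree lowering hypersurfaces and the criterion -/

/-- `V` is a degree lowering hypersurface of `f` with height `n`: `n` is the smallest integer
`≥ 1` with `f^n(V) ⊆ I(f)`. -/
def IsDegreeLowering {k : ℕ} (F : PolyMap k) (V : Set (PSpace k)) (n : ℕ) : Prop :=
  IsHypersurface V ∧ 1 ≤ n ∧ iterImage F n V ⊆ indeterminacy F ∧
    ∀ m, 1 ≤ m → m < n → ¬ iterImage F m V ⊆ indeterminacy F

/-- `S = {(H₁, n₁), …, (H_M, n_M)}` is a system of primitive degree lowering hypersurfaces of `f`
together with their heights. In `captures`, `f^m(V)` is taken before the height `n` of `V` is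
reached, i.e. while it is still the successive image of `V` under `f`. -/
structure IsPrimitiveSystem {k : ℕ} (F : PolyMap k) (S : Set (Set (PSpace k) × ℕ)) : Prop where
  finite : S.Finite
  degreeLowering : ∀ s ∈ S, IsDegreeLowering F s.1 s.2
  heights_ne : ∀ s ∈ S, ∀ t ∈ S, s ≠ t → s.2 ≠ t.2
  codim : ∀ s ∈ S, ∀ m, 1 ≤ m → m ≤ s.2 → CodimGtOne (iterImage F m s.1)
  captures : ∀ (V : Set (PSpace k)) (n : ℕ), IsIrreducibleHypersurface V →
    IsDegreeLowering F V n →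
      ∃ m < n, ∃ s ∈ S, IsHypersurface (iterImage F m V) ∧ iterImage F m V ⊆ s.1

/-- Conditions (i)–(iii) of the criterion for quasi-algebraic stability, where `H₀` is the unique
primitive degree lowering hypersurface and `n₀` is its height. -/
structure SatisfiesCriterion {k : ℕ} (F : PolyMap k) (H₀ : Set (PSpace k)) (n₀ : ℕ) : Prop where
  /-- (i) There is exactly one primitive degree lowering hypersurface: `H₀`, of height `n₀`. -/
  unique_primitive : ∀ S : Set (Set (PSpace k) × ℕ), IsPrimitiveSystem F S ↔ S = {(H₀, n₀)}
  /-- (ii) -/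
  not_subset : ∀ V, IsIrreducibleHypersurface V → V ⊆ H₀ →
    ∀ m, 1 ≤ m → m ≤ n₀ → ¬ iterImage F m V ⊆ H₀
  /-- (iii) -/
  after_height : ∀ V, IsIrreducibleHypersurface V → V ⊆ H₀ →
    (∀ m, n₀ + 1 ≤ m → ¬ iterImage F m V ⊆ indeterminacy F) ∨
    ∃ m₀, n₀ ≤ m₀ ∧ IsHypersurface (iterImage F (m₀ + 1) V) ∧
      ∀ m, n₀ + 1 ≤ m → m ≤ m₀ → ¬ iterImage F m V ⊆ indeterminacy F

/-! ### The family -/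

/-- The polynomial map `(P Q₁ - R, P Q₂ - R, P Q₃ - R)`. -/
noncomputable def familyMap (P R : Poly 2) (Q : Fin 3 → Poly 2) : PolyMap 2 :=
  fun j => P * Q j - R

/-- The point `[1 : 1 : 1]` of `ℙ²`. -/
noncomputable def onePoint : PSpace 2 :=
  Projectivization.mk ℂ (fun _ => 1) (fun h => one_ne_zero (congrFun h 0))

end QASMap

/-! Write F for the lifting given by the family, and F_j for its components. If the a_j sum to 0,
then Σ a_j F_j = P · Σ a_j Q_j, so a line through [1:1:1] pulls back to {P = 0} together with {Σ a_j
Q_j = 0}. A curve contracted by f to a point v lies in the preimage of a line joining v to [1:1:1].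
Condition 1 keeps it out of {Σ a_j Q_j = 0}, so it is a component of {P = 0}, and these components
are indeed contracted, all to the indeterminacy point [1:1:1] (`dvd_P_of_constMod`,
`nonConstMod_iff`). The same pencil of lines gives dominance (`eq_zero_of_bind₁_eq_zero`).

Expanding F around (1,1,1) gives F ∘ F = P^m F₂, where m is the multiplicity of F at (1,1,1) and F₂
vanishes identically on no component of {P = 0} (`exists_second_iterate`). By condition 2, F₂ is
nonconstant on each such component.

The liftings Φ_n of all iterates are then built by Φ_{n+2} = (F ∘ Φ_{n+1}) / (P^m ∘ Φ_n), which is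
quasi-algebraic stability with n₀ = 1 and H = P^m. Divisibility and absence of common factors are
carried by the invariant `GoodPair`, preserved in `goodPair_succ`: on each irreducible curve, either
Φ_n is nonconstant and no common factor along the curve is removed in passing to Φ_{n+1}, or Φ_n is
the point [1:1:1] and Φ_{n+1} is already nonconstant. As P(1,1,1) ≠ 0, the second case never meets
the divisor P ∘ Φ_n. The invariant also shows that a degree lowering curve must pass through a
component of {P = 0}, which determines the primitive system.

The algebraic tool is `NonConstMod.exists_generator`: if X is nonconstant on an irreducible curve {A
= 0}, the forms vanishing on the image are the multiples of one irreducible form B. Statements about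
X-images of curves thereby become statements about divisibility. -/

namespace QASMap

/-! ### Homogeneous polynomials -/

/-- The ring homomorphism `x ↦ x T`, which turns the grading into the degree in `T`. -/
noncomputable def scaleHom (σ : Type*) : MvPolynomial σ ℂ →ₐ[ℂ] Polynomial (MvPolynomial σ ℂ) :=
  aeval fun i => Polynomial.C (X i) * Polynomial.X

theorem scaleHom_monomial {σ : Type*} (s : σ →₀ ℕ) (c : ℂ) :
    scaleHom σ (monomial s c) = Polynomial.C (monomial s c) * Polynomial.X ^ s.degree := by
  rw [scaleHom, aeval_monomial, monomial_eq]
  simp only [mul_pow, Finsupp.prod_mul, Polynomial.C_mul, Polynomial.algebraMap_apply,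
    MvPolynomial.algebraMap_eq]
  rw [mul_assoc]
  congr 2
  · rw [Finsupp.prod, Finsupp.prod, map_prod]; simp
  · rw [Finsupp.prod, Finset.prod_pow_eq_pow_sum, Finsupp.degree]
    rfl

theorem coeff_scaleHom {σ : Type*} (G : MvPolynomial σ ℂ) (n : ℕ) :
    (scaleHom σ G).coeff n = homogeneousComponent n G := by
  induction G using MvPolynomial.induction_on' with
  | monomial s c =>
    rw [scaleHom_monomial, Polynomial.coeff_C_mul_X_pow, homogeneousComponent_of_mem (isHomogeneous_monomial c rfl)]
  | add p q hp hq => simp [hp, hq]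

theorem isHomogeneous_iff_scaleHom {σ : Type*} {G : MvPolynomial σ ℂ} {n : ℕ} :
    G.IsHomogeneous n ↔ scaleHom σ G = Polynomial.C G * Polynomial.X ^ n := by
  constructor
  · intro h
    ext1 k
    rw [coeff_scaleHom, Polynomial.coeff_C_mul_X_pow,
      homogeneousComponent_of_mem h]
  · intro h
    have := congrArg (fun g => Polynomial.coeff g n) h
    simp only [coeff_scaleHom, Polynomial.coeff_C_mul_X_pow, if_true] at this
    rw [← this]
    exact homogeneousComponent_isHomogeneous n G

/-- Over a domain both the degree and the order at 0 are additive. They agree for the product, so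
they agree for each factor. -/
theorem coeff_eq_zero_of_mul_eq_monomial {R : Type*} [CommRing R] [IsDomain R]
    {p q : Polynomial R} {r : R} {n : ℕ} (h : p * q = Polynomial.monomial n r) (hr : r ≠ 0)
    {k : ℕ} (hk : k ≠ p.natDegree) : p.coeff k = 0 := by
  have h0 : p * q ≠ 0 := by
    rw [h]; exact (Polynomial.monomial_eq_zero_iff _ _).not.mpr hr
  have hp := left_ne_zero_of_mul h0
  have hq := right_ne_zero_of_mul h0
  have h1 := congrArg Polynomial.natDegree h
  have h2 := congrArg Polynomial.natTrailingDegree h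
  rw [Polynomial.natDegree_mul hp hq, Polynomial.natDegree_monomial_eq _ hr] at h1
  rw [Polynomial.natTrailingDegree_mul hp hq, Polynomial.natTrailingDegree_monomial hr] at h2
  have h3 := Polynomial.natTrailingDegree_le_natDegree p
  have h4 := Polynomial.natTrailingDegree_le_natDegree q
  rcases lt_or_gt_of_ne hk with hk | hk
  · exact Polynomial.coeff_eq_zero_of_lt_natTrailingDegree (by omega)
  · exact Polynomial.coeff_eq_zero_of_natDegree_lt hk

theorem isHomogeneous_of_homogeneousComponent_eq_zero {σ : Type*} {A : MvPolynomial σ ℂ} {a : ℕ}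
    (hz : ∀ k, k ≠ a → homogeneousComponent k A = 0) : A.IsHomogeneous a := by
  intro d hd
  by_contra hne
  have h1 := congrArg (coeff d) (hz d.degree (by rw [Finsupp.degree_eq_weight_one]; exact hne))
  rw [coeff_homogeneousComponent, if_pos rfl] at h1
  exact hd h1

/-- Factors of nonzero homogeneous polynomials are homogeneous. -/
theorem isHomogeneous_of_mul {σ : Type*} {A B : MvPolynomial σ ℂ} {n : ℕ}
    (h : (A * B).IsHomogeneous n) (h0 : A * B ≠ 0) : ∃ a, A.IsHomogeneous a := by
  rw [isHomogeneous_iff_scaleHom, map_mul, Polynomial.C_mul_X_pow_eq_monomial] at h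
  refine ⟨(scaleHom σ A).natDegree, isHomogeneous_of_homogeneousComponent_eq_zero fun k hk => ?_⟩
  rw [← coeff_scaleHom]
  exact coeff_eq_zero_of_mul_eq_monomial h h0 hk

theorem isHomogeneous_of_dvd {σ : Type*} {A G : MvPolynomial σ ℂ} {n : ℕ}
    (hG : G.IsHomogeneous n) (h0 : G ≠ 0) (h : A ∣ G) : ∃ a, A.IsHomogeneous a := by
  obtain ⟨B, rfl⟩ := h
  exact isHomogeneous_of_mul hG h0

/-- A quotient of homogeneous polynomials is homogeneous. -/
theorem isHomogeneous_right_of_mul {σ : Type*} {A B : MvPolynomial σ ℂ} {a n : ℕ}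
    (hA : A.IsHomogeneous a) (hA0 : A ≠ 0) (h : (A * B).IsHomogeneous n) :
    B.IsHomogeneous (n - a) := by
  by_cases h0 : B = 0
  · rw [h0]; exact isHomogeneous_zero _ _ _
  obtain ⟨b, hb⟩ := isHomogeneous_of_mul (mul_comm A B ▸ h) (mul_ne_zero h0 hA0)
  have := (hA.mul hb).inj_right h (mul_ne_zero hA0 h0)
  rwa [← this, Nat.add_sub_cancel_left]

theorem IsHomogeneous.bind₁ {σ τ : Type*} {G : MvPolynomial σ ℂ} {X : σ → MvPolynomial τ ℂ}
    {g e : ℕ} (hG : G.IsHomogeneous g) (hX : ∀ i, (X i).IsHomogeneous e) :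
    (bind₁ X G).IsHomogeneous (e * g) :=
  hG.aeval _ hX

theorem bind₁_smul {σ τ : Type*} {G : MvPolynomial σ ℂ} {g : ℕ} (hG : G.IsHomogeneous g)
    (c : MvPolynomial τ ℂ) (X : σ → MvPolynomial τ ℂ) :
    bind₁ (fun i => c * X i) G = c ^ g * bind₁ X G := by
  conv_lhs => rw [G.as_sum]
  conv_rhs => rw [G.as_sum]
  rw [map_sum, map_sum, Finset.mul_sum]
  refine Finset.sum_congr rfl fun d hd => ?_
  have hd' : ∑ i ∈ d.support, d i = g := by
    have := hG (mem_support_iff.mp hd)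
    simpa [Finsupp.weight_apply, Finsupp.sum] using this
  rw [bind₁_monomial, bind₁_monomial]
  simp only [mul_pow, Finset.prod_mul_distrib, Finset.prod_pow_eq_pow_sum, hd']
  ring

theorem eval_bind₁ {σ τ : Type*} (x : τ → ℂ) (X : σ → MvPolynomial τ ℂ) (G : MvPolynomial σ ℂ) :
    eval x (bind₁ X G) = eval (fun i => eval x (X i)) G := by
  simp only [← coe_aeval_eq_eval, RingHom.coe_coe]
  rw [aeval_bind₁]

theorem eval_smul {σ : Type*} {G : MvPolynomial σ ℂ} {g : ℕ} (hG : G.IsHomogeneous g)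
    (c : ℂ) (x : σ → ℂ) : eval (c • x) G = c ^ g * eval x G := by
  have h := congrArg (eval (fun _ : σ => (0 : ℂ))) (bind₁_smul hG (C c) fun i => (C (x i) : MvPolynomial σ ℂ))
  rw [eval_bind₁, map_mul, map_pow, eval_bind₁] at h
  simpa [Pi.smul_def] using h

theorem exists_irreducible_homogeneous_dvd {σ : Type*} {G : MvPolynomial σ ℂ} {n : ℕ}
    (hG : G.IsHomogeneous n) (h0 : G ≠ 0) (hu : ¬ IsUnit G) :
    ∃ (A : MvPolynomial σ ℂ) (a : ℕ), A.IsHomogeneous a ∧ Irreducible A ∧ A ∣ G := by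
  obtain ⟨A, hA, hd⟩ := WfDvdMonoid.exists_irreducible_factor hu h0
  obtain ⟨a, ha⟩ := isHomogeneous_of_dvd hG h0 hd
  exact ⟨A, a, ha, hA, hd⟩

theorem not_isUnit_of_isHomogeneous {σ : Type*} {G : MvPolynomial σ ℂ} {n : ℕ} (hn : 0 < n)
    (hG : G.IsHomogeneous n) : ¬ IsUnit G := by
  intro h
  have h0 := hG.totalDegree h.ne_zero
  rw [(isUnit_iff_totalDegree_of_isReduced.mp h).2] at h0
  omega

theorem pos_of_irreducible {σ : Type*} {G : MvPolynomial σ ℂ} {n : ℕ}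
    (hG : G.IsHomogeneous n) (h : Irreducible G) : 0 < n := by
  rcases Nat.eq_zero_or_pos n with rfl | hn
  · exfalso
    apply h.not_isUnit
    have h1 := (totalDegree_zero_iff_isHomogeneous (p := G)).mpr hG
    have h2 := totalDegree_eq_zero_iff_eq_C.mp h1
    rw [h2]
    refine (IsUnit.mk0 _ fun h3 => h.ne_zero ?_).map C
    rw [h2, h3, C_0]
  · exact hn

/-! ### Projective relations -/

/-- A zero of a nonzero binary form is proportional to a constant vector. -/
theorem exists_linear_relation_of_binary_form {D : Type} [CommRing D] [IsDomain D] [Algebra ℂ D]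
    (u : Fin 2 → D) {b : MvPolynomial (Fin 2) ℂ} {n : ℕ} (hb : b.IsHomogeneous n) (hb0 : b ≠ 0)
    (h : aeval u b = 0) :
    ∃ α β : ℂ, (α ≠ 0 ∨ β ≠ 0) ∧ algebraMap ℂ D α * u 0 + algebraMap ℂ D β * u 1 = 0 := by
  by_cases hu : u 1 = 0
  · exact ⟨0, 1, Or.inr one_ne_zero, by simp [hu]⟩
  let K := FractionRing D
  let τ : K := algebraMap D K (u 0) / algebraMap D K (u 1)
  have hu' : algebraMap D K (u 1) ≠ 0 := by
    rwa [Ne, FaithfulSMul.algebraMap_eq_zero_iff]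
  let g : Polynomial ℂ := aeval ![Polynomial.X, 1] b
  have key : ∀ {E : Type} [Field E] [Algebra ℂ E] (x y : E), y ≠ 0 →
      aeval ![x, y] b = y ^ n * Polynomial.aeval (x / y) g := by
    intro E _ _ x y hy
    have h1 : Polynomial.aeval (x / y) g = aeval ![x / y, 1] b := by
      simp only [g]
      rw [← AlgHom.comp_apply]
      congr 1
      ext i
      fin_cases i <;> simp
    rw [h1, aeval_def, aeval_def, eval₂_eq, eval₂_eq, Finset.mul_sum]
    refine Finset.sum_congr rfl fun d hd => ?_
    have hd' : d 0 + d 1 = n := by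
      have := hb (mem_support_iff.mp hd)
      simpa [Finsupp.weight_apply, Finsupp.sum_fintype] using this
    have e1 : ∀ w : Fin 2 → E, ∏ i ∈ d.support, w i ^ d i = w 0 ^ d 0 * w 1 ^ d 1 := by
      intro w
      rw [← Fin.prod_univ_two (f := fun i => w i ^ d i)]
      exact Finset.prod_subset (Finset.subset_univ _) fun i _ hi => by
        simp [Finsupp.notMem_support_iff.mp hi]
    rw [e1, e1, ← hd']
    simp only [Matrix.cons_val_zero, Matrix.cons_val_one, div_pow, pow_add]
    field_simp
    simp
  have hg : g ≠ 0 := by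
    intro hg
    apply mul_ne_zero hb0 (X_ne_zero (R := ℂ) (1 : Fin 2))
    refine MvPolynomial.funext fun x => ?_
    rw [map_mul, map_zero, eval_X]
    by_cases hx : x 1 = 0
    · rw [hx, mul_zero]
    · have := key (x 0) (x 1) hx
      rw [hg, map_zero, mul_zero] at this
      have hx2 : ![x 0, x 1] = x := by ext i; fin_cases i <;> rfl
      rw [hx2] at this
      change eval x b = 0 at this
      rw [this, zero_mul]
  have hτ : Polynomial.aeval τ g = 0 := by
    have h1 := key (algebraMap D K (u 0)) (algebraMap D K (u 1)) hu'
    have h2 : aeval ![algebraMap D K (u 0), algebraMap D K (u 1)] b = algebraMap D K (aeval u b) := by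
      rw [← aeval_algebraMap_apply]
      congr 2
      ext i; fin_cases i <;> rfl
    rw [h2, h, map_zero] at h1
    exact (mul_eq_zero.mp h1.symm).resolve_left (pow_ne_zero _ hu')
  -- The ratio u₀/u₁ is a root of the dehomogenised form, hence algebraic over the algebraically
  -- closed field ℂ, hence a constant.
  have halg : IsAlgebraic ℂ τ := ⟨g, hg, hτ⟩
  obtain ⟨c, hc⟩ : τ ∈ (algebraMap ℂ K).range :=
    minpoly.mem_range_of_degree_eq_one ℂ τ
      (IsAlgClosed.degree_eq_one_of_irreducible ℂ (minpoly.irreducible halg.isIntegral))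
  refine ⟨1, -c, Or.inl one_ne_zero, ?_⟩
  apply FaithfulSMul.algebraMap_injective D K
  have h1 : algebraMap D K (u 0) = algebraMap ℂ K c * algebraMap D K (u 1) := by
    rw [hc]; exact (div_mul_cancel₀ _ hu').symm
  rw [map_add, map_mul, map_mul, ← IsScalarTower.algebraMap_apply,
    ← IsScalarTower.algebraMap_apply, h1,
    map_one, one_mul, map_neg, map_zero, neg_mul, add_neg_cancel]

/-! ### Polynomial maps restricted to an irreducible hypersurface -/

/-- On the hypersurface `{A = 0}`, the polynomial map `X` is proportional to the vector `v`. -/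
def ConstMod {k : ℕ} (A : Poly k) (X : PolyMap k) (v : Fin (k + 1) → ℂ) : Prop :=
  ∀ i j, A ∣ C (v i) * X j - C (v j) * X i

/-- On the hypersurface `{A = 0}`, the polynomial map `X` does not induce a constant map. -/
def NonConstMod {k : ℕ} (A : Poly k) (X : PolyMap k) : Prop :=
  ∀ v, v ≠ 0 → ¬ ConstMod A X v

theorem NonConstMod.exists_not_dvd {k : ℕ} {A : Poly k} {X : PolyMap k} (h : NonConstMod A X) :
    ∃ i, ¬ A ∣ X i := by
  by_contra! h'
  exact h (fun _ => 1) (fun h0 => one_ne_zero (congrFun h0 0)) fun i j =>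
    dvd_sub (dvd_mul_of_dvd_right (h' _) _) (dvd_mul_of_dvd_right (h' _) _)

/-- A transcendence degree count: if the k + 1 classes of the X i modulo A were algebraically
independent, the k + 1 coordinate classes, which generate the quotient, would be a transcendence
basis. But they satisfy the relation A. -/
theorem exists_ne_zero_dvd_bind₁ {k : ℕ} {A : Poly k} (hA : Irreducible A) (X : PolyMap k) :
    ∃ G : Poly k, G ≠ 0 ∧ A ∣ bind₁ X G := by
  have hp : (Ideal.span {A}).IsPrime :=
    (Ideal.span_singleton_prime hA.ne_zero).mpr hA.prime
  let D := Poly k ⧸ Ideal.span {A}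
  let φ : Poly k →ₐ[ℂ] D := Ideal.Quotient.mkₐ ℂ _
  have hφ : ∀ G, φ G = 0 ↔ A ∣ G := fun G => by
    rw [← Ideal.mem_span_singleton]; exact Ideal.Quotient.eq_zero_iff_mem
  by_contra! hcon
  have hind : AlgebraicIndependent ℂ fun i => φ (X i) := by
    rw [algebraicIndependent_iff]
    intro G hG
    by_contra hG0
    apply hcon G hG0
    rw [← hφ, ← hG, ← comp_aeval_apply]
    rfl
  have hle := hind.cardinalMk_le_trdeg
  have htop : Algebra.adjoin ℂ (Set.range fun i => φ (MvPolynomial.X i)) = ⊤ := by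
    have : (Set.range fun i => φ (MvPolynomial.X i)) = φ '' Set.range MvPolynomial.X := by
      rw [← Set.range_comp]; rfl
    rw [this, ← AlgHom.map_adjoin, adjoin_range_X, Algebra.map_top, AlgHom.range_eq_top]
    exact Ideal.Quotient.mkₐ_surjective _ _
  have halg : Algebra.IsAlgebraic (Algebra.adjoin ℂ (Set.range fun i => φ (MvPolynomial.X i))) D := by
    rw [htop]
    exact ⟨fun x => isAlgebraic_algebraMap (⟨x, trivial⟩ : (⊤ : Subalgebra ℂ D))⟩
  have hb := Algebra.IsAlgebraic.isTranscendenceBasis_of_le_trdeg_of_finite ℂ (fun i => φ (MvPolynomial.X i)) hle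
  have h0 := algebraicIndependent_iff.mp hb.1 A (by
    have : aeval (fun i => φ (MvPolynomial.X i)) = φ := by ext i; simp
    rw [this, hφ])
  exact hA.ne_zero h0

theorem dvd_homogeneousComponent {k : ℕ} {A G : Poly k} {a : ℕ} (hA : A.IsHomogeneous a)
    (h : A ∣ G) (n : ℕ) : A ∣ homogeneousComponent n G := by
  rw [← Ideal.mem_span_singleton] at h ⊢
  let _ : GradedAlgebra (homogeneousSubmodule (Fin (k + 1)) ℂ) := MvPolynomial.gradedAlgebra
  refine homogeneousComponent_mem_of_mem (Ideal.homogeneous_span _ _ fun x hx => ?_) h n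
  rw [Set.mem_singleton_iff.mp hx]
  exact ⟨a, hA⟩

/-- Since e > 0, different components of G land in different degrees e · n, and the ideal (A) is
homogeneous. -/
theorem dvd_bind₁_homogeneousComponent {k : ℕ} {A G : Poly k} {a e : ℕ} (hA : A.IsHomogeneous a)
    {X : PolyMap k} (hX : ∀ i, (X i).IsHomogeneous e) (he : 0 < e)
    (h : A ∣ bind₁ X G) (n : ℕ) : A ∣ bind₁ X (homogeneousComponent n G) := by
  have h1 := dvd_homogeneousComponent hA h (e * n)
  rw [← sum_homogeneousComponent G, map_sum, map_sum] at h1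
  have h2 : ∀ i, homogeneousComponent (e * n) (bind₁ X (homogeneousComponent i G)) =
      if i = n then bind₁ X (homogeneousComponent i G) else 0 := by
    intro i
    rw [homogeneousComponent_of_mem
      (IsHomogeneous.bind₁ (homogeneousComponent_isHomogeneous i G) hX)]
    simp [he.ne', eq_comm]
  simp only [h2] at h1
  rw [Finset.sum_ite_eq'] at h1
  split_ifs at h1 with h3
  · exact h1
  · rw [homogeneousComponent_eq_zero _ _ (by simpa using h3), map_zero]
    exact dvd_zero _

/-- By Gauss's lemma B stays irreducible over the fraction field and still does not divide G. A
Bézout identity with denominators cleared puts a nonzero constant of R in the ideal (B, G); it plays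
the role of a resultant. -/
theorem exists_ne_zero_eq_zero_of_not_dvd {R D : Type*} [CommRing R] [IsDomain R]
    [NormalizedGCDMonoid R] [CommRing D] [IsDomain D] (φ : Polynomial R →+* D)
    {B G : Polynomial R} (hB : Irreducible B) (hφB : φ B = 0) (hφG : φ G = 0) (h : ¬ B ∣ G) :
    ∃ r : R, r ≠ 0 ∧ φ (Polynomial.C r) = 0 := by
  by_cases hdeg : B.natDegree = 0
  · obtain ⟨r, hr⟩ := Polynomial.natDegree_eq_zero.mp hdeg
    refine ⟨r, fun h0 => hB.ne_zero (by rw [← hr, h0, Polynomial.C_0]), by rw [hr, hφB]⟩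
  classical
  let K := FractionRing R
  have hprim := hB.isPrimitive hdeg
  have hirr := (hprim.irreducible_iff_irreducible_map_fraction_map (K := K)).mp hB
  have hG0 : G ≠ 0 := fun h0 => h (h0 ▸ dvd_zero _)
  have hnd : ¬ B.map (algebraMap R K) ∣ G.map (algebraMap R K) := by
    rw [G.eq_C_content_mul_primPart, Polynomial.map_mul, Polynomial.map_C]
    intro h1
    have hu : IsUnit (Polynomial.C (algebraMap R K G.content)) := by
      refine (IsUnit.mk0 _ ?_).map Polynomial.C
      rw [Ne, FaithfulSMul.algebraMap_eq_zero_iff, Polynomial.content_eq_zero_iff]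
      exact hG0
    rw [hu.dvd_mul_left] at h1
    have h2 := hprim.dvd_of_fraction_map_dvd_fraction_map h1
    exact h (h2.trans G.primPart_dvd)
  obtain ⟨u, v, huv⟩ := (hirr.coprime_iff_not_dvd).mpr hnd
  obtain ⟨r, hr⟩ := IsLocalization.exist_integer_multiples_of_finset (nonZeroDivisors R)
    (u.coeffs ∪ v.coeffs)
  have hlift : ∀ w : Polynomial K, w.coeffs ⊆ u.coeffs ∪ v.coeffs →
      ∃ w' : Polynomial R, w'.map (algebraMap R K) = Polynomial.C (algebraMap R K r) * w := by
    intro w hw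
    rw [← Polynomial.mem_lifts, Polynomial.lifts_iff_coeff_lifts]
    intro n
    by_cases hn : w.coeff n = 0
    · exact ⟨0, by simp [hn]⟩
    · obtain ⟨s, hs⟩ := hr _ (hw (Polynomial.coeff_mem_coeffs hn))
      exact ⟨s, by rw [hs, Polynomial.coeff_C_mul, Algebra.smul_def]⟩
  obtain ⟨u', hu'⟩ := hlift u Finset.subset_union_left
  obtain ⟨v', hv'⟩ := hlift v Finset.subset_union_right
  refine ⟨r, nonZeroDivisors.ne_zero r.2, ?_⟩
  have h3 : u' * B + v' * G = Polynomial.C (r : R) := by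
    apply Polynomial.map_injective _ (FaithfulSMul.algebraMap_injective R K)
    rw [Polynomial.map_add, Polynomial.map_mul, Polynomial.map_mul, hu', hv', Polynomial.map_C,
      mul_assoc, mul_assoc, ← mul_add, huv, mul_one]
  rw [← h3, map_add, map_mul, map_mul, hφB, hφG, mul_zero, mul_zero, add_zero]

/-- Elimination of one variable. -/
theorem exists_binary_relation {D : Type} [CommRing D] [IsDomain D] [Algebra ℂ D]
    (φ : Poly 2 →ₐ[ℂ] D) {B G : Poly 2} (hB : Irreducible B) (hφB : φ B = 0) (hφG : φ G = 0)
    (h : ¬ B ∣ G) {i j : Fin 3} (hij : i ≠ j) :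
    ∃ r : MvPolynomial (Fin 2) ℂ, r ≠ 0 ∧ φ (rename ![i, j] r) = 0 := by
  obtain ⟨σ, h1, h2⟩ : ∃ σ : Equiv.Perm (Fin 3), σ 1 = i ∧ σ 2 = j := by
    revert i j; decide
  let E : Polynomial (MvPolynomial (Fin 2) ℂ) ≃ₐ[ℂ] Poly 2 :=
    (finSuccEquiv ℂ 2).symm.trans (renameEquiv ℂ σ)
  let _ : StrongNormalizationMonoid (MvPolynomial (Fin 2) ℂ) :=
    UniqueFactorizationMonoid.strongNormalizationMonoid
  let _ : NormalizedGCDMonoid (MvPolynomial (Fin 2) ℂ) :=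
    UniqueFactorizationMonoid.toNormalizedGCDMonoid _
  obtain ⟨r, hr0, hr⟩ := exists_ne_zero_eq_zero_of_not_dvd
    ((φ : Poly 2 →+* D).comp (E : Polynomial (MvPolynomial (Fin 2) ℂ) →+* Poly 2))
    (B := E.symm B) (G := E.symm G) ((MulEquiv.irreducible_iff E.symm).mpr hB)
    (by simpa using hφB) (by simpa using hφG) (by rwa [map_dvd_iff])
  refine ⟨r, hr0, ?_⟩
  rw [← hr]
  have h3 : ∀ r : MvPolynomial (Fin 2) ℂ, E (Polynomial.C r) = rename ![i, j] r := by
    intro r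
    have : (finSuccEquiv ℂ 2).symm (Polynomial.C r) = rename Fin.succ r := by
      rw [AlgEquiv.symm_apply_eq]
      induction r using MvPolynomial.induction_on with
      | C a => rw [rename_C]; exact (AlgEquiv.commutes (MvPolynomial.finSuccEquiv ℂ 2) a).symm
      | add p q hp hq => rw [map_add, map_add, map_add, hp, hq]
      | mul_X p l hp => rw [map_mul, map_mul, map_mul, hp, rename_X, finSuccEquiv_X_succ]
    change rename σ ((finSuccEquiv ℂ 2).symm (Polynomial.C r)) = _
    rw [this, rename_rename]
    congr 1
    congr 1
    ext l
    fin_cases l <;> simp [← h1, ← h2]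
  simp [h3]

theorem exists_linear_relation {A : Poly 2} {a e : ℕ} (hA : A.IsHomogeneous a)
    (hAi : Irreducible A) {X : PolyMap 2} (hX : ∀ i, (X i).IsHomogeneous e) (he : 0 < e)
    {B G : Poly 2} (hB : Irreducible B) (hXB : A ∣ bind₁ X B) (hXG : A ∣ bind₁ X G)
    (h : ¬ B ∣ G) {i j : Fin 3} (hij : i ≠ j) :
    ∃ α β : ℂ, (α ≠ 0 ∨ β ≠ 0) ∧ A ∣ C α * X i + C β * X j := by
  have hp : (Ideal.span {A}).IsPrime :=
    (Ideal.span_singleton_prime hAi.ne_zero).mpr hAi.prime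
  let D := Poly 2 ⧸ Ideal.span {A}
  let φ : Poly 2 →ₐ[ℂ] D := Ideal.Quotient.mkₐ ℂ _
  have hφ : ∀ G, φ G = 0 ↔ A ∣ G := fun G => by
    rw [← Ideal.mem_span_singleton]; exact Ideal.Quotient.eq_zero_iff_mem
  obtain ⟨r, hr0, hr⟩ := exists_binary_relation (φ.comp (bind₁ X)) hB ((hφ _).mpr hXB)
    ((hφ _).mpr hXG) h hij
  obtain ⟨n, hn⟩ : ∃ n, homogeneousComponent n r ≠ 0 := by
    by_contra! h0
    apply hr0
    rw [← sum_homogeneousComponent r]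
    exact Finset.sum_eq_zero fun n _ => h0 n
  have h1 : A ∣ bind₁ X (rename ![i, j] (homogeneousComponent n r)) := by
    rw [rename_homogeneousComponent]
    exact dvd_bind₁_homogeneousComponent hA hX he ((hφ _).mp hr) n
  rw [bind₁_rename, ← hφ] at h1
  obtain ⟨α, β, h2, h3⟩ := exists_linear_relation_of_binary_form
    (fun l => φ (X (![i, j] l))) (homogeneousComponent_isHomogeneous n r) hn (by
      rw [← h1]
      exact (comp_aeval_apply (fun l => X (![i, j] l)) φ _).symm)
  refine ⟨α, β, h2, (hφ _).mp ?_⟩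
  rw [map_add, map_mul, map_mul]
  simpa using h3

theorem dvd_of_dvd_C_mul {k : ℕ} {A G : Poly k} {c : ℂ} (hc : c ≠ 0) (h : A ∣ C c * G) : A ∣ G :=
  ((IsUnit.mk0 c hc).map C).dvd_mul_left.mp h

/-- If `X` is not constant on the irreducible curve `{A = 0}`, then the ideal of the image of this
curve is generated by an irreducible homogeneous polynomial. -/
theorem NonConstMod.exists_generator {A : Poly 2} {a e : ℕ} (hA : A.IsHomogeneous a)
    (hAi : Irreducible A) {X : PolyMap 2} (hX : ∀ i, (X i).IsHomogeneous e)
    (hN : NonConstMod A X) :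
    ∃ (B : Poly 2) (b : ℕ), B.IsHomogeneous b ∧ Irreducible B ∧ ∀ G, A ∣ bind₁ X G ↔ B ∣ G := by
  obtain ⟨i, hi⟩ := hN.exists_not_dvd
  -- In degree 0 the map consists of constants, so it would be constant on the curve.
  have he : 0 < e := by
    rcases Nat.eq_zero_or_pos e with rfl | he
    · exfalso
      have h1 : ∀ j, X j = C ((X j).coeff 0) := fun j =>
        totalDegree_eq_zero_iff_eq_C.mp ((totalDegree_zero_iff_isHomogeneous (p := X j)).mpr (hX j))
      refine hN (fun j => (X j).coeff 0) (fun h0 => hi ?_) fun i j => ?_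
      · rw [h1 i, congrFun h0 i]; simp
      · rw [← h1 i, ← h1 j, mul_comm, sub_self]; exact dvd_zero _
    · exact he
  have hprime : Prime A := hAi.prime
  obtain ⟨G, hG0, hG⟩ := exists_ne_zero_dvd_bind₁ hAi X
  obtain ⟨n, hn⟩ : ∃ n, homogeneousComponent n G ≠ 0 := by
    by_contra! h0
    apply hG0
    rw [← sum_homogeneousComponent G]
    exact Finset.sum_eq_zero fun n _ => h0 n
  have hGn := dvd_bind₁_homogeneousComponent hA hX he hG n
  obtain ⟨B, hBi, hBG, hXB⟩ : ∃ B, Irreducible B ∧ B ∣ homogeneousComponent n G ∧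
      A ∣ bind₁ X B := by
    revert hGn hn
    generalize homogeneousComponent n G = g
    induction g using UniqueFactorizationMonoid.induction_on_prime with
    | h₁ => intro h; exact absurd rfl h
    | h₂ x hx => intro _ h; exact absurd (isUnit_of_dvd_unit h (hx.map (bind₁ X))) hAi.not_isUnit
    | h₃ x p hx hp ih =>
      intro _ h
      rw [map_mul] at h
      rcases hprime.dvd_or_dvd h with h | h
      · exact ⟨p, hp.irreducible, dvd_mul_right _ _, h⟩
      · obtain ⟨B, h1, h2, h3⟩ := ih hx h
        exact ⟨B, h1, h2.mul_left _, h3⟩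
  obtain ⟨b, hb⟩ := isHomogeneous_of_dvd (homogeneousComponent_isHomogeneous n G) hn hBG
  refine ⟨B, b, hb, hBi, fun G' => ⟨fun hG' => ?_, fun h => hXB.trans (map_dvd (bind₁ X) h)⟩⟩
  by_contra hnd
  -- Two relations without common factor allow elimination of any one variable. The resulting binary
  -- forms split into linear factors over ℂ, so all components are proportional to X i modulo A.
  have hrel : ∀ j, ∃ c : ℂ, A ∣ X j - C c * X i := by
    intro j
    by_cases hij : i = j
    · exact ⟨1, by simp [hij]⟩
    obtain ⟨α, β, h0, h1⟩ := exists_linear_relation hA hAi hX he hBi hXB hG' hnd hij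
    have hβ : β ≠ 0 := by
      rintro rfl
      rw [C_0, zero_mul, add_zero] at h1
      exact hi (dvd_of_dvd_C_mul (h0.resolve_right (not_not.mpr rfl)) h1)
    refine ⟨-(α / β), dvd_of_dvd_C_mul hβ ?_⟩
    have : C β * (X j - C (-(α / β)) * X i) = C (β * (α / β)) * X i + C β * X j := by
      rw [C_mul, C_neg]; ring
    rw [this, mul_div_cancel₀ _ hβ]
    exact h1
  choose c hc using hrel
  by_cases hc0 : c = 0
  · apply hi
    simpa [hc0] using hc i
  · refine hN c hc0 fun j l => ?_
    have : C (c j) * X l - C (c l) * X j =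
        C (c j) * (X l - C (c l) * X i) - C (c l) * (X j - C (c j) * X i) := by ring
    rw [this]
    exact dvd_sub ((hc l).mul_left _) ((hc j).mul_left _)

/-! ### Curves in the plane and their images -/

theorem exists_not_dvd_X {A : Poly 2} (hA : Irreducible A) : ∃ i : Fin 3, ¬ A ∣ X i := by
  by_contra! h
  have h1 : (X 0 : Poly 2) ∣ X 1 :=
    (hA.dvd_symm (X_prime (R := ℂ) (i := (0 : Fin 3))).irreducible (h 0)).trans (h 1)
  rw [X_dvd_X] at h1
  exact absurd h1 (by decide)

/-- A curve is not a point: otherwise A would divide two independent linear forms, and by degree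
both would be scalar multiples of A. -/
theorem nonConstMod_X {A : Poly 2} (hA : Irreducible A) : NonConstMod A X := by
  intro v hv h
  obtain ⟨k, hk⟩ : ∃ k, v k ≠ 0 := by
    by_contra! h0
    exact hv (funext h0)
  obtain ⟨i, j, hik, hjk, hij⟩ : ∃ i j : Fin 3, i ≠ k ∧ j ≠ k ∧ i ≠ j := by
    clear hk
    revert k; decide
  have hlin : ∀ l, (C (v k) * X l - C (v l) * X k : Poly 2).IsHomogeneous 1 := fun l =>
    (isHomogeneous_C_mul_X _ _).sub (isHomogeneous_C_mul_X _ _)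
  have heval : ∀ l m, m ≠ k → eval (Pi.single m 1) (C (v k) * X l - C (v l) * X k : Poly 2) =
      if l = m then v k else 0 := by
    intro l m hm
    by_cases hlm : l = m <;> simp [hm.symm, hlm]
  have hquot : ∀ l, l ≠ k → ∃ γ : ℂ, γ ≠ 0 ∧ C (v k) * X l - C (v l) * X k = A * C γ := by
    intro l hl
    obtain ⟨c, hc⟩ := h k l
    have h0 : (C (v k) * X l - C (v l) * X k : Poly 2) ≠ 0 := by
      intro h0
      have := heval l l hl
      rw [h0, map_zero, if_pos rfl] at this
      exact hk this.symm
    obtain ⟨a, ha⟩ := isHomogeneous_of_dvd (hlin l) h0 (h k l)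
    have ha0 := pos_of_irreducible ha hA
    have h1 := hlin l
    rw [hc] at h1
    have h2 := isHomogeneous_right_of_mul ha hA.ne_zero h1
    rw [Nat.sub_eq_zero_of_le ha0] at h2
    have h3 := totalDegree_eq_zero_iff_eq_C.mp ((totalDegree_zero_iff_isHomogeneous (p := c)).mpr h2)
    refine ⟨coeff 0 c, fun h4 => h0 ?_, by rw [← h3, hc]⟩
    rw [hc, h3, h4, C_0, mul_zero]
  obtain ⟨γ, -, h1⟩ := hquot i hik
  obtain ⟨δ, hδ, h2⟩ := hquot j hjk
  have h3 := heval j i hik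
  rw [h2, if_neg hij.symm, map_mul, eval_C] at h3
  have h4 := heval i i hik
  rw [h1, if_pos rfl, map_mul, (mul_eq_zero.mp h3).resolve_right hδ, zero_mul] at h4
  exact hk h4.symm

/-- The projective Nullstellensatz for irreducible curves. -/
theorem zeroLocus_subset_zeroLocus_iff {A G : Poly 2} {a g : ℕ} (hA : A.IsHomogeneous a)
    (hAi : Irreducible A) (hG : G.IsHomogeneous g) : zeroLocus A ⊆ zeroLocus G ↔ A ∣ G := by
  constructor
  · intro h
    have hprime : (Ideal.span {A}).IsPrime :=
      (Ideal.span_singleton_prime hAi.ne_zero).mpr hAi.prime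
    -- The factor X i takes care of the origin, which lies on the affine cone but has no counterpart
    -- in the projective curve.
    have key : ∀ i : Fin 3, A ∣ G * X i := by
      intro i
      rw [← Ideal.mem_span_singleton, ← MvPolynomial.IsPrime.vanishingIdeal_zeroLocus (K := ℂ)
        (Ideal.span {A}), mem_vanishingIdeal_iff]
      intro x hx
      have hx' : eval x A = 0 := hx A (Ideal.mem_span_singleton_self A)
      change eval x (G * X i) = 0
      by_cases hx0 : x = 0
      · simp [hx0]
      · rw [map_mul, (mk_mem_zeroLocus hG x hx0).mp (h ((mk_mem_zeroLocus hA x hx0).mpr hx')),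
          zero_mul]
    obtain ⟨i, hi⟩ := exists_not_dvd_X hAi
    exact (hAi.prime.dvd_or_dvd (key i)).resolve_right hi
  · rintro ⟨B, rfl⟩ p hp
    change eval p.rep (A * B) = 0
    rw [map_mul, show eval p.rep A = 0 from hp, zero_mul]

theorem zeroLocus_mono {k : ℕ} {A G : Poly k} (h : A ∣ G) : zeroLocus A ⊆ zeroLocus G := by
  obtain ⟨B, rfl⟩ := h
  intro p hp
  change eval p.rep (A * B) = 0
  rw [map_mul, show eval p.rep A = 0 from hp, zero_mul]

theorem isHypersurface_zeroLocus {k : ℕ} {A : Poly k} {a : ℕ} (hA : A.IsHomogeneous a)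
    (hAi : Irreducible A) : IsHypersurface (zeroLocus A) :=
  ⟨A, a, pos_of_irreducible hA hAi, hA, hAi.ne_zero, rfl⟩

theorem exists_component_of_mem {k : ℕ} {G : Poly k} {g : ℕ} (hG : G.IsHomogeneous g) (h0 : G ≠ 0)
    {p : PSpace k} (hp : p ∈ zeroLocus G) :
    ∃ (A : Poly k) (a : ℕ), A.IsHomogeneous a ∧ Irreducible A ∧ A ∣ G ∧ p ∈ zeroLocus A := by
  obtain ⟨A, hA, hd, hpA⟩ : ∃ A, Irreducible A ∧ A ∣ G ∧ p ∈ zeroLocus A := by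
    clear hG
    induction G using UniqueFactorizationMonoid.induction_on_prime with
    | h₁ => exact absurd rfl h0
    | h₂ x hx => exact absurd (hp : eval p.rep x = 0) (hx.map (eval p.rep)).ne_zero
    | h₃ x q hx hq ih =>
      have h1 : eval p.rep (q * x) = 0 := hp
      rw [map_mul] at h1
      rcases mul_eq_zero.mp h1 with h1 | h1
      · exact ⟨q, hq.irreducible, dvd_mul_right _ _, h1⟩
      · obtain ⟨B, h2, h3, h4⟩ := ih hx h1
        exact ⟨B, h2, h3.mul_left _, h4⟩
  obtain ⟨a, ha⟩ := isHomogeneous_of_dvd hG h0 hd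
  exact ⟨A, a, ha, hA, hd, hpA⟩

theorem mem_zariskiClosure_self {k : ℕ} {S : Set (PSpace k)} : S ⊆ zariskiClosure S :=
  fun _ hp _ _ _ h => h hp

theorem image_mono {k : ℕ} {F : PolyMap k} {V W : Set (PSpace k)} (h : V ⊆ W) :
    image F V ⊆ image F W := by
  intro p hp G e hG hS
  refine hp G e hG (subset_trans ?_ hS)
  rintro p ⟨q, hq, h0, rfl⟩
  exact ⟨q, h hq, h0, rfl⟩

theorem image_subset_zeroLocus_iff {A : Poly 2} {a e g : ℕ} (hA : A.IsHomogeneous a)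
    (hAi : Irreducible A) {F : PolyMap 2} (hF : ∀ i, (F i).IsHomogeneous e) (hd : ∃ i, ¬ A ∣ F i)
    {G : Poly 2} (hG : G.IsHomogeneous g) :
    image F (zeroLocus A) ⊆ zeroLocus G ↔ A ∣ bind₁ F G := by
  -- The factor F i makes the condition void at the indeterminacy points, which the image ignores.
  have h1 : image F (zeroLocus A) ⊆ zeroLocus G ↔
      ∀ i, zeroLocus A ⊆ zeroLocus (bind₁ F G * F i) := by
    constructor
    · intro h i q hq
      change eval q.rep (bind₁ F G * F i) = 0
      by_cases h0 : evalMap F q.rep = 0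
      · rw [map_mul, show eval q.rep (F i) = 0 from congrFun h0 i, mul_zero]
      · rw [map_mul, eval_bind₁]
        have := h (mem_zariskiClosure_self ⟨q, hq, h0, rfl⟩)
        rw [mk_mem_zeroLocus hG] at this
        rw [show eval (fun i => eval q.rep (F i)) G = 0 from this, zero_mul]
    · intro h p hp
      refine hp G g hG ?_
      rintro _ ⟨q, hq, h0, rfl⟩
      rw [mk_mem_zeroLocus hG]
      obtain ⟨i, hi⟩ : ∃ i, evalMap F q.rep i ≠ 0 := by
        by_contra! h1
        exact h0 (funext h1)
      have h2 : eval q.rep (bind₁ F G * F i) = 0 := h i hq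
      rw [map_mul, eval_bind₁] at h2
      exact (mul_eq_zero.mp h2).resolve_right hi
  rw [h1]
  have h2 : ∀ i, zeroLocus A ⊆ zeroLocus (bind₁ F G * F i) ↔ A ∣ bind₁ F G * F i := fun i =>
    zeroLocus_subset_zeroLocus_iff hA hAi ((IsHomogeneous.bind₁ hG hF).mul (hF i))
  simp only [h2]
  obtain ⟨i, hi⟩ := hd
  exact ⟨fun h => (hAi.prime.dvd_or_dvd (h i)).resolve_right hi, fun h j => h.mul_right _⟩

theorem mem_image_iff {k : ℕ} {F : PolyMap k} {V : Set (PSpace k)} {p : PSpace k} :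
    p ∈ image F V ↔ ∀ (G : Poly k) (g : ℕ), G.IsHomogeneous g → image F V ⊆ zeroLocus G →
      p ∈ zeroLocus G :=
  ⟨fun hp _ _ _ h => h hp, fun h G g hG hS => h G g hG fun _ hq => hq G g hG hS⟩

theorem eq_mk_of_forall_mem {v : Fin 3 → ℂ} (hv : v ≠ 0) {p : PSpace 2}
    (h : ∀ i j, p ∈ zeroLocus (C (v i) * X j - C (v j) * X i : Poly 2)) :
    p = Projectivization.mk ℂ v hv := by
  have h1 : ∀ i j, v i * p.rep j = v j * p.rep i := fun i j => by
    have : eval p.rep (C (v i) * X j - C (v j) * X i : Poly 2) = 0 := h i j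
    simpa [sub_eq_zero] using this
  obtain ⟨k, hk⟩ : ∃ k, v k ≠ 0 := by
    by_contra! h0
    exact hv (funext h0)
  rw [← p.mk_rep, Projectivization.mk_eq_mk_iff']
  refine ⟨p.rep k / v k, funext fun j => ?_⟩
  have := h1 k j
  simp only [Pi.smul_apply, smul_eq_mul]
  field_simp
  linear_combination -this

theorem NonConstMod.image_eq {A B : Poly 2} {a b e : ℕ} (hA : A.IsHomogeneous a)
    (hAi : Irreducible A) {F : PolyMap 2} (hF : ∀ i, (F i).IsHomogeneous e)
    (hN : NonConstMod A F) (hB : B.IsHomogeneous b) (h : ∀ G, A ∣ bind₁ F G ↔ B ∣ G) :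
    image F (zeroLocus A) = zeroLocus B := by
  apply Set.Subset.antisymm
  · rw [image_subset_zeroLocus_iff hA hAi hF hN.exists_not_dvd hB, h]
  · intro p hp
    rw [mem_image_iff]
    intro G g hG hS
    rw [image_subset_zeroLocus_iff hA hAi hF hN.exists_not_dvd hG, h] at hS
    exact zeroLocus_mono hS hp

/-- Modulo A the vectors v_l F and F_l v agree; apply the form G to both. -/
theorem ConstMod.pow_mul_sub {k : ℕ} {A : Poly k} {F : PolyMap k} {v : Fin (k + 1) → ℂ}
    (h : ConstMod A F v) (l : Fin (k + 1)) {G : Poly k} {g : ℕ} (hG : G.IsHomogeneous g) :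
    A ∣ C (v l) ^ g * bind₁ F G - F l ^ g * C (eval v G) := by
  rw [← bind₁_smul hG, ← Ideal.mem_span_singleton]
  have h1 : F l ^ g * C (eval v G) = bind₁ (fun i => F l * C (v i)) G := by
    rw [bind₁_smul hG]
    exact congrArg _ (aeval_algebraMap_apply (Poly k) v G).symm
  rw [h1, ← Ideal.Quotient.eq_zero_iff_mem, map_sub, sub_eq_zero]
  change (Ideal.Quotient.mkₐ ℂ (Ideal.span {A})) _ = (Ideal.Quotient.mkₐ ℂ (Ideal.span {A})) _
  simp only [bind₁]
  rw [comp_aeval_apply, comp_aeval_apply]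
  congr 2
  ext i
  have := Ideal.mem_span_singleton.mpr (h l i)
  rw [← Ideal.Quotient.eq_zero_iff_mem, map_sub, sub_eq_zero] at this
  rw [mul_comm (F l)]
  exact this

theorem ConstMod.not_dvd {k : ℕ} {A : Poly k} {F : PolyMap k} {v : Fin (k + 1) → ℂ}
    (h : ConstMod A F v) (hd : ∃ i, ¬ A ∣ F i) {l : Fin (k + 1)} (hl : v l ≠ 0) : ¬ A ∣ F l := by
  intro h1
  obtain ⟨i, hi⟩ := hd
  exact hi (dvd_of_dvd_C_mul hl ((dvd_sub_left (h1.mul_left _)).mp (h l i)))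

theorem ConstMod.dvd_bind₁_iff {k : ℕ} {A : Poly k} (hAi : Irreducible A) {F : PolyMap k}
    {v : Fin (k + 1) → ℂ} (hv : v ≠ 0) (h : ConstMod A F v) (hd : ∃ i, ¬ A ∣ F i) {G : Poly k}
    {g : ℕ} (hG : G.IsHomogeneous g) : A ∣ bind₁ F G ↔ eval v G = 0 := by
  obtain ⟨l, hl⟩ : ∃ k, v k ≠ 0 := by
    by_contra! h0
    exact hv (funext h0)
  have h1 := h.pow_mul_sub l hG
  have h2 := h.not_dvd hd hl
  constructor
  · intro h3
    by_contra h4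
    have h5 := (dvd_sub_right (h3.mul_left _)).mp h1
    rw [mul_comm] at h5
    exact h2 (hAi.prime.dvd_of_dvd_pow (dvd_of_dvd_C_mul h4 h5))
  · intro h3
    rw [h3, C_0, mul_zero, sub_zero, ← C_pow] at h1
    exact dvd_of_dvd_C_mul (pow_ne_zero _ hl) h1

theorem ConstMod.image_eq {A : Poly 2} {a e : ℕ} (hA : A.IsHomogeneous a)
    (hAi : Irreducible A) {F : PolyMap 2} (hF : ∀ i, (F i).IsHomogeneous e)
    {v : Fin 3 → ℂ} (hv : v ≠ 0) (h : ConstMod A F v) (hd : ∃ i, ¬ A ∣ F i) :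
    image F (zeroLocus A) = {Projectivization.mk ℂ v hv} := by
  apply Set.Subset.antisymm
  · intro p hp
    refine eq_mk_of_forall_mem hv fun i j => ?_
    refine (image_subset_zeroLocus_iff hA hAi hF hd (g := 1) ?_).mpr ?_ hp
    · exact (isHomogeneous_C_mul_X _ _).sub (isHomogeneous_C_mul_X _ _)
    · simpa using h i j
  · rintro _ rfl
    rw [mem_image_iff]
    intro G g hG hS
    rwa [image_subset_zeroLocus_iff hA hAi hF hd hG, h.dvd_bind₁_iff hAi hv hd hG,
      ← mk_mem_zeroLocus hG v hv] at hS

/-- A point is not a curve. -/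
theorem not_zeroLocus_subset_singleton {A : Poly 2} {a : ℕ} (hA : A.IsHomogeneous a)
    (hAi : Irreducible A) (p : PSpace 2) : ¬ zeroLocus A ⊆ {p} := by
  intro h
  refine nonConstMod_X hAi p.rep p.rep_nonzero fun i j => ?_
  rw [← zeroLocus_subset_zeroLocus_iff hA hAi (g := 1)
    ((isHomogeneous_C_mul_X _ _).sub (isHomogeneous_C_mul_X _ _))]
  intro q hq
  rw [Set.mem_singleton_iff.mp (h hq)]
  change eval p.rep _ = 0
  simp [mul_comm]

theorem IsHypersurface.not_subset_singleton {V : Set (PSpace 2)} (hV : IsHypersurface V)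
    (p : PSpace 2) : ¬ V ⊆ {p} := by
  obtain ⟨G, g, hg, hG, hG0, rfl⟩ := hV
  obtain ⟨A, a, hA, hAi, hd⟩ := exists_irreducible_homogeneous_dvd hG hG0
    (not_isUnit_of_isHomogeneous hg hG)
  exact fun h => not_zeroLocus_subset_singleton hA hAi p ((zeroLocus_mono hd).trans h)

theorem nonConstMod_of_isHypersurface_image {A : Poly 2} {a e : ℕ} (hA : A.IsHomogeneous a)
    (hAi : Irreducible A) {F : PolyMap 2} (hF : ∀ i, (F i).IsHomogeneous e) (hd : ∃ i, ¬ A ∣ F i)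
    (h : IsHypersurface (image F (zeroLocus A))) : NonConstMod A F := by
  intro v hv hc
  refine h.not_subset_singleton (Projectivization.mk ℂ v hv) ?_
  rw [hc.image_eq hA hAi hF hv hd]

/-! ### Liftings of iterates -/

/-- Cancel the prime factors of c one at a time. This makes the removed common factor, and so the
lifting of an iterate, unique up to a constant. -/
theorem dvd_of_forall_dvd_mul {k : ℕ} {G : PolyMap k} (hG : NoCommonFactor G) {c d : Poly k}
    (hc : c ≠ 0) (h : ∀ i, c ∣ d * G i) : c ∣ d := by
  induction c using UniqueFactorizationMonoid.induction_on_prime generalizing d with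
  | h₁ => exact absurd rfl hc
  | h₂ x hx => exact hx.dvd
  | h₃ x q hx hq ih =>
    obtain ⟨i, hi⟩ : ∃ i, ¬ q ∣ G i := by
      by_contra! h0
      exact hq.not_isUnit (hG q h0)
    obtain ⟨d', rfl⟩ := (hq.dvd_or_dvd ((dvd_mul_right _ _).trans (h i))).resolve_right hi
    refine mul_dvd_mul_left q (ih hx fun j => ?_)
    have := h j
    rwa [mul_assoc, mul_dvd_mul_iff_left hq.ne_zero] at this

theorem IsIterateLifting.eq_C_mul {k : ℕ} {F : PolyMap k} {n : ℕ} {G G' : PolyMap k}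
    (h : IsIterateLifting F n G) (h' : IsIterateLifting F n G') :
    ∃ u : ℂ, u ≠ 0 ∧ ∀ i, G' i = C u * G i := by
  obtain ⟨hG, c, hc, h1⟩ := h
  obtain ⟨hG', c', hc', h1'⟩ := h'
  have h2 : c' ∣ c := dvd_of_forall_dvd_mul hG hc' fun i => by
    rw [← h1 i, h1' i]; exact dvd_mul_right _ _
  have h3 : c ∣ c' := dvd_of_forall_dvd_mul hG' hc fun i => by
    rw [← h1' i, h1 i]; exact dvd_mul_right _ _
  obtain ⟨u, hu⟩ := associated_of_dvd_dvd h2 h3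
  obtain ⟨r, hr, hru⟩ := isUnit_iff_eq_C_of_isReduced.mp u.isUnit
  refine ⟨r, hr.ne_zero, fun i => mul_left_cancel₀ hc' ?_⟩
  rw [← h1' i, h1 i, ← hu, hru]
  ring

theorem IsIterateLifting.C_mul {k : ℕ} {F : PolyMap k} {n : ℕ} {G : PolyMap k}
    (h : IsIterateLifting F n G) {u : ℂ} (hu : u ≠ 0) :
    IsIterateLifting F n fun i => C u * G i := by
  obtain ⟨hG, c, hc, h1⟩ := h
  refine ⟨fun A hA => hG A fun i => dvd_of_dvd_C_mul hu (hA i), c * C u⁻¹,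
    mul_ne_zero hc (C_ne_zero.mpr (inv_ne_zero hu)), fun i => ?_⟩
  rw [h1 i, mul_assoc, ← mul_assoc (C u⁻¹), ← MvPolynomial.C_mul, inv_mul_cancel₀ hu, C_1, one_mul]

theorem image_C_mul {k : ℕ} (G : PolyMap k) {u : ℂ} (hu : u ≠ 0) (V : Set (PSpace k)) :
    image (fun i => C u * G i) V = image G V := by
  unfold image
  congr 1
  have he : ∀ x, evalMap (fun i => C u * G i) x = u • evalMap G x := fun x => by
    ext i; simp [evalMap]
  ext p
  constructor
  · rintro ⟨q, hq, h0, rfl⟩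
    refine ⟨q, hq, fun h1 => h0 (by rw [he, h1, smul_zero]), ?_⟩
    rw [Projectivization.mk_eq_mk_iff']
    exact ⟨u, (he _).symm⟩
  · rintro ⟨q, hq, h0, rfl⟩
    refine ⟨q, hq, by rw [he]; exact smul_ne_zero hu h0, ?_⟩
    rw [Projectivization.mk_eq_mk_iff']
    exact ⟨u⁻¹, by rw [he, smul_smul, inv_mul_cancel₀ hu, one_smul]⟩

theorem IsIterateLifting.iterImage_eq {k : ℕ} {F : PolyMap k} {n : ℕ} {G : PolyMap k}
    (h : IsIterateLifting F n G) (V : Set (PSpace k)) : iterImage F n V = image G V := by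
  ext p
  constructor
  · rintro ⟨G', h', hp⟩
    obtain ⟨u, hu, h1⟩ := h.eq_C_mul h'
    rw [funext h1, image_C_mul G hu] at hp
    exact hp
  · exact fun hp => ⟨G, h, hp⟩

theorem isIterateLifting_zero {F : PolyMap 2} : IsIterateLifting F 0 X := by
  refine ⟨fun A hA => ?_, 1, one_ne_zero, fun i => (one_mul _).symm⟩
  by_contra hu
  obtain ⟨B, hB, hd⟩ := WfDvdMonoid.exists_irreducible_factor hu
    (ne_zero_of_dvd_ne_zero (X_ne_zero 0) (hA 0))
  obtain ⟨i, hi⟩ := exists_not_dvd_X hB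
  exact hi (hd.trans (hA i))

theorem isIterateLifting_one {k : ℕ} {F : PolyMap k} (hF : NoCommonFactor F) :
    IsIterateLifting F 1 F :=
  ⟨hF, 1, one_ne_zero, fun i => by
    rw [one_mul]; exact congrArg (fun f => f (F i)) (aeval_unique (AlgHom.id ℂ (Poly k))).symm⟩

theorem iterImage_zero {F : PolyMap 2} {G : Poly 2} {g : ℕ} (hG : G.IsHomogeneous g) :
    iterImage F 0 (zeroLocus G) = zeroLocus G := by
  rw [isIterateLifting_zero.iterImage_eq]
  have hev : ∀ q : PSpace 2, evalMap X q.rep = q.rep := fun q => by ext i; simp [evalMap]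
  apply Set.Subset.antisymm
  · intro p hp
    refine hp G g hG ?_
    rintro _ ⟨q, hq, h0, rfl⟩
    rw [mk_mem_zeroLocus hG, hev]
    exact hq
  · intro p hp
    refine mem_zariskiClosure_self ⟨p, hp, by rw [hev]; exact p.rep_nonzero, ?_⟩
    simp [hev]

/-- The vector a gives a line through [1:1:1] and v. -/
theorem exists_sum_eq_zero_and (v : Fin 3 → ℂ) :
    ∃ a : Fin 3 → ℂ, a ≠ 0 ∧ ∑ j, a j = 0 ∧ ∑ j, a j * v j = 0 := by
  by_cases h : v 0 = v 1
  · refine ⟨![1, -1, 0], fun h0 => one_ne_zero (congrFun h0 0), ?_, ?_⟩ <;>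
      simp [Fin.sum_univ_three, h]
  · refine ⟨![v 1 - v 2, v 2 - v 0, v 0 - v 1],
      fun h0 => h (sub_eq_zero.mp (congrFun h0 2)), ?_, ?_⟩ <;>
    · simp only [Fin.sum_univ_three, Matrix.cons_val_zero, Matrix.cons_val_one, Matrix.cons_val]
      ring

theorem NoCommonFactor.exists_not_dvd {k : ℕ} {F : PolyMap k} (hF : NoCommonFactor F) {A : Poly k}
    (hA : Irreducible A) : ∃ i, ¬ A ∣ F i := by
  by_contra! h
  exact hA.not_isUnit (hF A h)

theorem polyIterate_one {k : ℕ} (F : PolyMap k) : polyIterate F 1 = F :=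
  funext fun i => congrArg (fun f => f (F i)) (aeval_unique (AlgHom.id ℂ (Poly k))).symm

/-- The hypotheses on the family, in terms of irreducible polynomials. -/
structure FamilyHyp (p q : ℕ) (P R : Poly 2) (Q : Fin 3 → Poly 2) : Prop where
  pos : 0 < p
  homP : P.IsHomogeneous p
  homQ : ∀ j, (Q j).IsHomogeneous q
  homR : R.IsHomogeneous (p + q)
  eval_one : ∀ j, eval (fun _ => (1 : ℂ)) P * eval (fun _ => (1 : ℂ)) (Q j) =
    eval (fun _ => (1 : ℂ)) R
  eval_R : eval (fun _ => (1 : ℂ)) R ≠ 0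
  noCommonFactor : NoCommonFactor (familyMap P R Q)
  nonConst : ∀ a : Fin 3 → ℂ, a ≠ 0 → ∑ j, a j = 0 → ∀ (A : Poly 2) (e : ℕ), A.IsHomogeneous e →
    Irreducible A → A ∣ ∑ j, C (a j) * Q j → NonConstMod A (familyMap P R Q)

/-! ### Contracted curves and dominance of the family -/

namespace FamilyHyp

variable {p q : ℕ} {P R : Poly 2} {Q : Fin 3 → Poly 2}

theorem homF (h : FamilyHyp p q P R Q) (j : Fin 3) : (familyMap P R Q j).IsHomogeneous (p + q) :=
  (h.homP.mul (h.homQ j)).sub h.homR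

theorem evalP (h : FamilyHyp p q P R Q) : eval (fun _ => (1 : ℂ)) P ≠ 0 := by
  intro h0
  have := h.eval_one 0
  rw [h0, zero_mul] at this
  exact h.eval_R this.symm

theorem P_ne_zero (h : FamilyHyp p q P R Q) : P ≠ 0 := by
  intro h0
  exact h.evalP (by rw [h0, map_zero])

theorem exists_component (h : FamilyHyp p q P R Q) :
    ∃ (A : Poly 2) (a : ℕ), A.IsHomogeneous a ∧ Irreducible A ∧ A ∣ P :=
  exists_irreducible_homogeneous_dvd h.homP h.P_ne_zero (not_isUnit_of_isHomogeneous h.pos h.homP)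

theorem sum_familyMap {a : Fin 3 → ℂ} (ha : ∑ j, a j = 0) :
    ∑ j, C (a j) * familyMap P R Q j = P * ∑ j, C (a j) * Q j := by
  have : (∑ j, C (a j) : Poly 2) = 0 := by rw [← map_sum, ha, C_0]
  rw [Fin.sum_univ_three] at this ⊢
  rw [Fin.sum_univ_three]
  simp only [familyMap]
  linear_combination -R * this

theorem not_dvd_R (h : FamilyHyp p q P R Q) {A : Poly 2} (hA : Irreducible A) (hP : A ∣ P) :
    ¬ A ∣ R := by
  intro hR
  obtain ⟨i, hi⟩ := h.noCommonFactor.exists_not_dvd hA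
  exact hi (dvd_sub (hP.mul_right _) hR)

theorem constMod_of_dvd {A : Poly 2} (hP : A ∣ P) : ConstMod A (familyMap P R Q) fun _ => 1 := by
  intro i j
  have : C 1 * familyMap P R Q j - C 1 * familyMap P R Q i = P * (Q j - Q i) := by
    simp only [familyMap, C_1]; ring
  rw [this]
  exact hP.mul_right _

theorem one_ne_zero' : (fun _ => 1 : Fin 3 → ℂ) ≠ 0 := fun h => one_ne_zero (congrFun h 0)

/-- The line through [1:1:1] and the image point v pulls back to P · Σ a_j Q_j, which A therefore
divides; condition 1 excludes the second factor. -/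
theorem dvd_P_of_constMod (h : FamilyHyp p q P R Q) {A : Poly 2} {e : ℕ} (hA : A.IsHomogeneous e)
    (hAi : Irreducible A) {v : Fin 3 → ℂ} (hv : v ≠ 0) (hc : ConstMod A (familyMap P R Q) v) :
    A ∣ P := by
  obtain ⟨a, ha, hs, hav⟩ := exists_sum_eq_zero_and v
  obtain ⟨k, hk⟩ : ∃ k, v k ≠ 0 := by
    by_contra! h0
    exact hv (funext h0)
  have h1 : A ∣ P * ∑ j, C (a j) * Q j := by
    rw [← sum_familyMap (R := R) hs]
    apply dvd_of_dvd_C_mul hk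
    have h2 : C (v k) * ∑ j, C (a j) * familyMap P R Q j =
        ∑ j, C (a j) * (C (v k) * familyMap P R Q j - C (v j) * familyMap P R Q k) := by
      have h3 : (∑ j, C (a j) * C (v j) : Poly 2) = 0 := by
        simp_rw [← C_mul]; rw [← map_sum, hav, C_0]
      rw [Fin.sum_univ_three] at h3 ⊢
      rw [Fin.sum_univ_three]
      linear_combination familyMap P R Q k * h3
    rw [h2]
    exact Finset.dvd_sum fun j _ => (hc k j).mul_left _
  refine (hAi.prime.dvd_or_dvd h1).resolve_right fun h2 => ?_
  exact h.nonConst a ha hs A e hA hAi h2 v hv hc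

theorem nonConstMod_iff (h : FamilyHyp p q P R Q) {A : Poly 2} {e : ℕ} (hA : A.IsHomogeneous e)
    (hAi : Irreducible A) : NonConstMod A (familyMap P R Q) ↔ ¬ A ∣ P :=
  ⟨fun hN hP => hN _ one_ne_zero' (constMod_of_dvd hP),
    fun hP _ hv hc => hP (h.dvd_P_of_constMod hA hAi hv hc)⟩

/-- If the sum vanished, condition 1 would apply to every curve, including the components of {P =
0}, which are contracted. -/
theorem sum_Q_ne_zero (h : FamilyHyp p q P R Q) {a : Fin 3 → ℂ} (ha : a ≠ 0)
    (hs : ∑ j, a j = 0) : ∑ j, C (a j) * Q j ≠ 0 := by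
  intro h0
  obtain ⟨A, e, hA, hAi, hd⟩ := h.exists_component
  exact (h.nonConstMod_iff hA hAi).mp (h.nonConst a ha hs A e hA hAi (h0 ▸ dvd_zero A)) hd

theorem q_pos (h : FamilyHyp p q P R Q) : 0 < q := by
  rcases Nat.eq_zero_or_pos q with rfl | hq
  · exfalso
    have h1 : ∀ j, Q j = C ((Q j).coeff 0) := fun j =>
      totalDegree_eq_zero_iff_eq_C.mp
        ((totalDegree_zero_iff_isHomogeneous (p := Q j)).mpr (h.homQ j))
    obtain ⟨a, ha, hs, hav⟩ := exists_sum_eq_zero_and fun j => (Q j).coeff 0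
    apply h.sum_Q_ne_zero ha hs
    rw [← C_0, ← hav, map_sum]
    refine Finset.sum_congr rfl fun j _ => ?_
    rw [C_mul, ← h1]
  · exact hq

/-- The components of the family are algebraically independent. -/
theorem eq_zero_of_bind₁_eq_zero (h : FamilyHyp p q P R Q) {G : Poly 2}
    (h0 : bind₁ (familyMap P R Q) G = 0) : G = 0 := by
  refine MvPolynomial.funext fun x => ?_
  rw [map_zero]
  -- A component of {Σ a_j Q_j = 0} is mapped onto the line through [1:1:1] and x. A form that
  -- vanishes on the whole image therefore vanishes at x.
  obtain ⟨a, ha, hs, hax⟩ := exists_sum_eq_zero_and x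
  have hhom : (∑ j, C (a j) * Q j).IsHomogeneous q :=
    IsHomogeneous.sum _ _ _ fun j _ => (h.homQ j).C_mul _
  obtain ⟨A, e, hA, hAi, hd⟩ := exists_irreducible_homogeneous_dvd hhom (h.sum_Q_ne_zero ha hs)
    (not_isUnit_of_isHomogeneous h.q_pos hhom)
  obtain ⟨B, b, hB, hBi, hgen⟩ := (h.nonConst a ha hs A e hA hAi hd).exists_generator hA hAi h.homF
  have hlin : (∑ j, C (a j) * X j : Poly 2).IsHomogeneous 1 :=
    IsHomogeneous.sum _ _ _ fun j _ => isHomogeneous_C_mul_X _ _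
  have hBl : B ∣ ∑ j, C (a j) * X j := by
    rw [← hgen]
    have : bind₁ (familyMap P R Q) (∑ j, C (a j) * X j) = ∑ j, C (a j) * familyMap P R Q j := by
      simp
    rw [this, sum_familyMap hs]
    exact hd.mul_left _
  obtain ⟨D, hD⟩ := hBl
  have hD0 : D.IsHomogeneous 0 := by
    rw [hD] at hlin
    have := isHomogeneous_right_of_mul hB hBi.ne_zero hlin
    rwa [Nat.sub_eq_zero_of_le (pos_of_irreducible hB hBi)] at this
  have hDC := totalDegree_eq_zero_iff_eq_C.mp
    ((totalDegree_zero_iff_isHomogeneous (p := D)).mpr hD0)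
  have hne : coeff 0 D ≠ 0 := by
    intro h1
    apply ha
    ext i
    have h2 := congrArg (eval (Pi.single i 1)) hD
    rw [hDC, h1, C_0, mul_zero] at h2
    simpa [Pi.single_apply] using h2
  have hBx : eval x B = 0 := by
    have h2 := congrArg (eval x) hD
    rw [hDC] at h2
    simp only [map_sum, map_mul, eval_C, eval_X, hax] at h2
    exact (mul_eq_zero.mp h2.symm).resolve_right hne
  obtain ⟨E, rfl⟩ := (hgen G).mp (h0 ▸ dvd_zero A)
  rw [map_mul, hBx, zero_mul]

theorem isDominantSelfMap (h : FamilyHyp p q P R Q) : IsDominantSelfMap (familyMap P R Q) := by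
  refine ⟨⟨p + q, h.homF⟩, h.noCommonFactor, Set.eq_univ_of_forall fun x G g hG hS => ?_⟩
  obtain ⟨A, -, -, hAi, -⟩ := h.exists_component
  obtain ⟨i, hi⟩ := h.noCommonFactor.exists_not_dvd hAi
  have h1 : bind₁ (familyMap P R Q) G * familyMap P R Q i = 0 := by
    have hhom := (IsHomogeneous.bind₁ hG h.homF).mul (h.homF i)
    refine hhom.eq_zero_of_forall_eval_eq_zero fun y => ?_
    by_cases hy : y = 0
    · rw [hy, map_mul, ← zero_smul ℂ (0 : Fin 3 → ℂ), eval_smul (h.homF i),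
        zero_pow (by have := h.pos; omega), zero_mul, mul_zero]
    · rw [← mk_mem_zeroLocus hhom y hy]
      generalize Projectivization.mk ℂ y hy = q'
      change eval q'.rep _ = 0
      rw [map_mul, eval_bind₁]
      by_cases h0 : evalMap (familyMap P R Q) q'.rep = 0
      · rw [show eval q'.rep (familyMap P R Q i) = 0 from congrFun h0 i, mul_zero]
      · have := hS ⟨q', Set.mem_univ _, h0, rfl⟩
        rw [mk_mem_zeroLocus hG] at this
        rw [show eval (fun i => eval q'.rep (familyMap P R Q i)) G = 0 from this, zero_mul]
  have h2 := (mul_eq_zero.mp h1).resolve_right fun h0 => hi (h0 ▸ dvd_zero A)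
  rw [h.eq_zero_of_bind₁_eq_zero h2]
  change eval x.rep 0 = 0
  exact map_zero _

end FamilyHyp

/-! ### The second iterate -/

/-- The linear change of coordinates `(x₀, x₁, x₂) ↦ (x₀, x₁ + x₀, x₂ + x₀)`. -/
noncomputable def shear : Poly 2 →ₐ[ℂ] Poly 2 :=
  bind₁ ![X 0, X 1 + X 0, X 2 + X 0]

theorem shear_injective : Function.Injective shear := by
  have h : (bind₁ ![X 0, X 1 - X 0, X 2 - X 0] : Poly 2 →ₐ[ℂ] Poly 2).comp shear =
      AlgHom.id ℂ _ := by
    ext1 i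
    fin_cases i <;> simp [shear]
  have h' : ∀ G, bind₁ ![X 0, X 1 - X 0, X 2 - X 0] (shear G) = G :=
    fun G => congrArg (fun f => f G) h
  exact Function.LeftInverse.injective h'

theorem isHomogeneous_shear {G : Poly 2} {g : ℕ} (hG : G.IsHomogeneous g) :
    (shear G).IsHomogeneous g := by
  have := IsHomogeneous.bind₁ hG (X := (![X 0, X 1 + X 0, X 2 + X 0] : PolyMap 2)) (e := 1) (by
    intro i
    fin_cases i
    · exact isHomogeneous_X _ _
    · exact (isHomogeneous_X _ _).add (isHomogeneous_X _ _)
    · exact (isHomogeneous_X _ _).add (isHomogeneous_X _ _))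
  rwa [one_mul] at this

/-- The sheared form is evaluated at (Y 0, Y 1 - Y 0, Y 2 - Y 0) and regarded as a polynomial in its
first variable. -/
theorem bind₁_eq_eval_shear (Y : PolyMap 2) (G : Poly 2) :
    bind₁ Y G = Polynomial.eval₂ (aeval (R := ℂ) fun i : Fin 2 => Y i.succ - Y 0 : _ →+* Poly 2)
      (Y 0) (finSuccEquiv ℂ 2 (shear G)) := by
  induction G using MvPolynomial.induction_on with
  | C a =>
    have : finSuccEquiv ℂ 2 (shear (C a)) = Polynomial.C (C a) := by
      rw [shear, bind₁_C_right]
      exact AlgEquiv.commutes (finSuccEquiv ℂ 2) a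
    rw [this, Polynomial.eval₂_C, bind₁_C_right]
    simp
  | add f g hf hg => rw [map_add, map_add, map_add, Polynomial.eval₂_add, hf, hg]
  | mul_X f i hf =>
    rw [map_mul, map_mul, map_mul, Polynomial.eval₂_mul, hf]
    congr 1
    have h1 : finSuccEquiv ℂ 2 (X 1) = Polynomial.C (X 0) := finSuccEquiv_X_succ (j := (0 : Fin 2))
    have h2 : finSuccEquiv ℂ 2 (X 2) = Polynomial.C (X 1) := finSuccEquiv_X_succ (j := (1 : Fin 2))
    fin_cases i <;> simp [shear, h1, h2, finSuccEquiv_X_zero]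

/-- Expansion of a form around the point `[1 : 1 : 1]`. -/
theorem bind₁_eq_sum_shear {G : Poly 2} {g : ℕ} (hG : G.IsHomogeneous g) (Y : PolyMap 2) (S : Poly 2)
    (w : Fin 2 → Poly 2) (hw : ∀ i, Y i.succ - Y 0 = S * w i) :
    bind₁ Y G = ∑ i ∈ Finset.range (g + 1),
      S ^ (g - i) * aeval w ((finSuccEquiv ℂ 2 (shear G)).coeff i) * Y 0 ^ i := by
  rw [bind₁_eq_eval_shear, Polynomial.eval₂_eq_sum_range' _ (n := g + 1)]
  · refine Finset.sum_congr rfl fun i hi => ?_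
    have hi' : i + (g - i) = g := by
      have := Finset.mem_range.mp hi
      omega
    have := bind₁_smul ((isHomogeneous_shear hG).finSuccEquiv_coeff_isHomogeneous i _ hi') S w
    simp only [← hw] at this
    exact congrArg (· * _) this
  · rw [Nat.lt_succ_iff, natDegree_finSuccEquiv]
    exact (degreeOf_le_totalDegree _ _).trans (isHomogeneous_shear hG).totalDegree_le

namespace FamilyHyp

variable {p q : ℕ} {P R : Poly 2} {Q : Fin 3 → Poly 2}

/-- The differences F_i - F_0 are divisible by P, so in the expansion around (1,1,1) a term of order
s carries the factor P^s. The lowest order terms determine the power of P to be removed. -/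
theorem exists_second_iterate (h : FamilyHyp p q P R Q) :
    ∃ (m : ℕ) (F₂ : PolyMap 2),
      (∀ j, bind₁ (familyMap P R Q) (familyMap P R Q j) = P ^ m * F₂ j) ∧
      ∀ (A : Poly 2) (a : ℕ), A.IsHomogeneous a → Irreducible A → A ∣ P → ∃ j, ¬ A ∣ F₂ j := by
  classical
  set F := familyMap P R Q with hFdef
  let g : Fin 3 → ℕ → MvPolynomial (Fin 2) ℂ := fun j i => (finSuccEquiv ℂ 2 (shear (F j))).coeff i
  let w : Fin 2 → Poly 2 := fun i => Q i.succ - Q 0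
  have hw : ∀ i : Fin 2, F i.succ - F 0 = P * w i := fun i => by
    simp only [hFdef, familyMap, w]; ring
  have hsum := fun j => bind₁_eq_sum_shear (h.homF j) F P w hw
  have hex : ∃ i, i ≤ p + q ∧ ∃ j, g j i ≠ 0 := by
    by_contra! hcon
    obtain ⟨A, -, -, hAi, -⟩ := h.exists_component
    obtain ⟨j, hj⟩ := h.noCommonFactor.exists_not_dvd hAi
    apply hj
    have : F j = 0 := by
      apply shear_injective
      apply (finSuccEquiv ℂ 2).injective
      rw [map_zero, map_zero]
      ext1 i
      by_cases hi : i ≤ p + q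
      · exact hcon i hi j
      · rw [Polynomial.coeff_zero]
        apply Polynomial.coeff_eq_zero_of_natDegree_lt
        rw [natDegree_finSuccEquiv]
        exact lt_of_le_of_lt ((degreeOf_le_totalDegree _ _).trans
          (isHomogeneous_shear (h.homF j)).totalDegree_le) (not_le.mp hi)
    change A ∣ F j
    rw [this]
    exact dvd_zero A
  obtain ⟨i₀, hi₀, hj₀⟩ := hex
  -- The index i is the power of the first variable, so the greatest i corresponds to the least
  -- order p + q - i at (1,1,1).
  let M := Nat.findGreatest (fun i => ∃ j, g j i ≠ 0) (p + q)
  have hM : ∃ j, g j M ≠ 0 := Nat.findGreatest_spec (P := fun i => ∃ j, g j i ≠ 0) hi₀ hj₀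
  have hMle : M ≤ p + q := Nat.findGreatest_le _
  have hgt : ∀ i, M < i → i ≤ p + q → ∀ j, g j i = 0 := fun i h1 h2 j => by
    by_contra h3
    exact Nat.findGreatest_is_greatest h1 h2 ⟨j, h3⟩
  refine ⟨p + q - M, fun j => ∑ i ∈ Finset.range (M + 1), P ^ (M - i) * aeval w (g j i) * F 0 ^ i,
    fun j => ?_, fun A a hA hAi hd => ?_⟩
  · rw [hsum j, Finset.mul_sum]
    symm
    have hsub : Finset.range (M + 1) ⊆ Finset.range (p + q + 1) := Finset.range_mono (by omega)
    rw [← Finset.sum_subset hsub]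
    · refine Finset.sum_congr rfl fun i hi => ?_
      have := Finset.mem_range.mp hi
      rw [← mul_assoc, ← mul_assoc, ← pow_add]
      congr 3
      omega
    · intro i hi hi'
      have h1 := Finset.mem_range.mp hi
      have h2 : ¬ i < M + 1 := fun h3 => hi' (Finset.mem_range.mpr h3)
      have h3 : g j i = 0 := hgt i (by omega) (by omega) j
      change _ * aeval w (g j i) * _ = 0
      rw [h3, map_zero, mul_zero, zero_mul]
  · obtain ⟨j, hj⟩ := hM
    refine ⟨j, fun hdvd => ?_⟩
    have hF0 : ¬ A ∣ F 0 := fun h1 => h.not_dvd_R hAi hd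
      ((dvd_sub_right (hd.mul_right _)).mp h1)
    -- Modulo A only the term i = M survives, and F 0 is not divisible by A because it is -R modulo
    -- A.
    have h1 : A ∣ aeval w (g j M) := by
      beta_reduce at hdvd
      rw [Finset.sum_range_succ, Nat.sub_self, pow_zero, one_mul, dvd_add_right] at hdvd
      · exact (hAi.prime.dvd_or_dvd hdvd).resolve_right fun h2 =>
          hF0 (hAi.prime.dvd_of_dvd_pow h2)
      · refine Finset.dvd_sum fun i hi => ?_
        have := Finset.mem_range.mp hi
        rw [mul_assoc]
        exact (hd.trans (dvd_pow_self _ (by omega))).mul_right _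
    have hp : (Ideal.span {A}).IsPrime :=
      (Ideal.span_singleton_prime hAi.ne_zero).mpr hAi.prime
    let φ : Poly 2 →ₐ[ℂ] Poly 2 ⧸ Ideal.span {A} := Ideal.Quotient.mkₐ ℂ _
    have hφ : ∀ G, φ G = 0 ↔ A ∣ G := fun G => by
      rw [← Ideal.mem_span_singleton]; exact Ideal.Quotient.eq_zero_iff_mem
    obtain ⟨α, β, h2, h3⟩ := exists_linear_relation_of_binary_form (fun l => φ (w l))
      ((isHomogeneous_shear (h.homF j)).finSuccEquiv_coeff_isHomogeneous M (p + q - M) (by omega))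
      hj (by rw [← (hφ _).mpr h1]; exact (comp_aeval_apply w φ _).symm)
    -- The relation α (Q 1 - Q 0) + β (Q 2 - Q 0) = 0 modulo A has coefficients of sum 0, so
    -- condition 1 contradicts the contraction of the component A of P.
    have h4 : A ∣ ∑ l, C ((![-α - β, α, β] : Fin 3 → ℂ) l) * Q l := by
      rw [← hφ]
      simp only [w] at h3
      rw [Fin.sum_univ_three, map_add, map_add, map_mul, map_mul, map_mul]
      simp only [← MvPolynomial.algebraMap_eq, AlgHom.commutes]
      simp only [Matrix.cons_val_zero, Matrix.cons_val_one, Matrix.cons_val, map_sub, map_neg]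
      simp only [map_sub, Fin.succ_zero_eq_one, Fin.succ_one_eq_two] at h3
      linear_combination h3
    refine (h.nonConstMod_iff hA hAi).mp (h.nonConst _ (fun h0 => ?_) ?_ A a hA hAi h4) hd
    · rcases h2 with h2 | h2
      · exact h2 (congrFun h0 1)
      · exact h2 (congrFun h0 2)
    · simp only [Fin.sum_univ_three, Matrix.cons_val_zero, Matrix.cons_val_one, Matrix.cons_val]
      ring

end FamilyHyp

/-! ### Inductive construction of the liftings of all iterates -/

theorem NoCommonFactor.of_irreducible {k : ℕ} {X : PolyMap k} {e : ℕ}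
    (hX : ∀ i, (X i).IsHomogeneous e) {i₀ : Fin (k + 1)} (h0 : X i₀ ≠ 0)
    (h : ∀ (A : Poly k) (a : ℕ), A.IsHomogeneous a → Irreducible A → ∃ i, ¬ A ∣ X i) :
    NoCommonFactor X := by
  intro A hA
  by_contra hu
  obtain ⟨B, hB, hd⟩ := WfDvdMonoid.exists_irreducible_factor hu (ne_zero_of_dvd_ne_zero h0 (hA i₀))
  obtain ⟨b, hb⟩ := isHomogeneous_of_dvd (hX i₀) h0 (hd.trans (hA i₀))
  obtain ⟨i, hi⟩ := h B b hb hB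
  exact hi (hd.trans (hA i))

theorem mem_indeterminacy_iff {k : ℕ} {F : PolyMap k} {p : PSpace k} :
    p ∈ indeterminacy F ↔ ∀ i, p ∈ zeroLocus (F i) :=
  ⟨fun h i => congrFun h i, fun h => funext h⟩

/-- The data of the second iterate `F₂ = (F ∘ F) / P ^ m` of the family. -/
structure SecondIterate (p q : ℕ) (P R : Poly 2) (Q : Fin 3 → Poly 2) (m : ℕ)
    (F₂ : PolyMap 2) : Prop extends FamilyHyp p q P R Q where
  eq_mul : ∀ j, bind₁ (familyMap P R Q) (familyMap P R Q j) = P ^ m * F₂ j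
  nonConst₂ : ∀ (A : Poly 2) (a : ℕ), A.IsHomogeneous a → Irreducible A → A ∣ P →
    NonConstMod A F₂

/-- Two consecutive liftings `X`, `Y` of iterates, with `c Y = F ∘ X`, such that on each
irreducible curve either `X` is not constant, or `X` is the point `[1 : 1 : 1]` and `Y` is not
constant. -/
structure GoodPair (F X Y : PolyMap 2) (c : Poly 2) : Prop where
  homX : ∃ e, ∀ i, (X i).IsHomogeneous e
  homY : ∃ e, ∀ i, (Y i).IsHomogeneous e
  c_ne : c ≠ 0
  dominant : ∀ (G : Poly 2) (g : ℕ), G.IsHomogeneous g → bind₁ X G = 0 → G = 0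
  eq_mul : ∀ i, c * Y i = bind₁ X (F i)
  alt : ∀ (A : Poly 2) (a : ℕ), A.IsHomogeneous a → Irreducible A →
    (NonConstMod A X ∧ ¬ A ∣ c) ∨
      (ConstMod A X (fun _ => 1) ∧ (∃ i, ¬ A ∣ X i) ∧ NonConstMod A Y)

namespace GoodPair

variable {F X Y : PolyMap 2} {c : Poly 2}

/-- Away from the removed factor c, the behaviour of Y on {A = 0} is that of F on the image curve {B
= 0}. -/
theorem constMod_mul (h : ∀ i, c * Y i = bind₁ X (F i)) {A B : Poly 2} (hAi : Irreducible A)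
    (hc : ¬ A ∣ c) (hgen : ∀ G, A ∣ bind₁ X G ↔ B ∣ G) {v : Fin 3 → ℂ} :
    ConstMod A Y v ↔ ConstMod B F v := by
  refine forall_congr' fun i => forall_congr' fun j => ?_
  rw [← hgen, map_sub, map_mul, map_mul, ← h, ← h, bind₁_C_right, bind₁_C_right]
  have : C (v i) * (c * Y j) - C (v j) * (c * Y i) = c * (C (v i) * Y j - C (v j) * Y i) := by ring
  rw [this]
  exact ⟨fun h => h.mul_left _, fun h => (hAi.prime.dvd_or_dvd h).resolve_left hc⟩

theorem exists_not_dvd (h : GoodPair F X Y c) (A : Poly 2) (a : ℕ) (hA : A.IsHomogeneous a)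
    (hAi : Irreducible A) : ∃ i, ¬ A ∣ X i := by
  rcases h.alt A a hA hAi with h1 | h1
  · exact h1.1.exists_not_dvd
  · exact h1.2.1

theorem noCommonFactor (h : GoodPair F X Y c) : NoCommonFactor X := by
  obtain ⟨e, he⟩ := h.homX
  refine NoCommonFactor.of_irreducible he (i₀ := 0) (fun h0 => ?_) h.exists_not_dvd
  refine X_ne_zero (R := ℂ) (0 : Fin 3) (h.dominant _ 1 (isHomogeneous_X _ _) ?_)
  rw [bind₁_X_right, h0]

end GoodPair

namespace SecondIterate

variable {p q m : ℕ} {P R : Poly 2} {Q : Fin 3 → Poly 2} {F₂ : PolyMap 2}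

theorem goodPair_zero (h : SecondIterate p q P R Q m F₂) :
    GoodPair (familyMap P R Q) X (familyMap P R Q) 1 where
  homX := ⟨1, fun i => isHomogeneous_X _ _⟩
  homY := ⟨p + q, h.homF⟩
  c_ne := one_ne_zero
  dominant G _ _ h0 := by
    rw [← h0]; exact congrArg (fun f => f G) (aeval_unique (AlgHom.id ℂ (Poly 2)))
  eq_mul i := by
    rw [one_mul]
    exact congrArg (fun f => f (familyMap P R Q i)) (aeval_unique (AlgHom.id ℂ (Poly 2)))
  alt A _ _ hAi := Or.inl ⟨nonConstMod_X hAi, fun h1 => hAi.not_isUnit (isUnit_of_dvd_one h1)⟩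

/-- From c Y = F ∘ X one gets c^(p+q) (F ∘ Y) = (P ∘ X)^m (F₂ ∘ X). Since c is prime to P ∘ X, the
power (P ∘ X)^m divides F ∘ Y, and the quotient Z satisfies c^(p+q) Z = F₂ ∘ X. -/
theorem goodPair_succ (h : SecondIterate p q P R Q m F₂) {X Y : PolyMap 2} {c : Poly 2}
    (hXY : GoodPair (familyMap P R Q) X Y c) :
    ∃ Z : PolyMap 2, GoodPair (familyMap P R Q) Y Z (bind₁ X P ^ m) := by
  obtain ⟨x, hx⟩ := hXY.homX
  obtain ⟨y, hy⟩ := hXY.homY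
  have hPX : bind₁ X P ≠ 0 := fun h0 => h.P_ne_zero (hXY.dominant P p h.homP h0)
  have hPXh := IsHomogeneous.bind₁ h.homP hx
  have hcomp : ∀ (G : Poly 2) (g : ℕ), G.IsHomogeneous g →
      c ^ g * bind₁ Y G = bind₁ X (bind₁ (familyMap P R Q) G) := by
    intro G g hG
    rw [← bind₁_smul hG, funext hXY.eq_mul, bind₁_bind₁]
  have hF₂ : ∀ i, c ^ (p + q) * bind₁ Y (familyMap P R Q i) = bind₁ X P ^ m * bind₁ X (F₂ i) := by
    intro i
    rw [hcomp _ _ (h.homF i), h.eq_mul, map_mul, map_pow]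
  have hbeta : ∀ A : Poly 2, Irreducible A → ConstMod A X (fun _ => 1) → (∃ i, ¬ A ∣ X i) →
      ¬ A ∣ bind₁ X P := fun A hAi h1 h2 h3 =>
    h.evalP ((h1.dvd_bind₁_iff hAi FamilyHyp.one_ne_zero' h2 h.homP).mp h3)
  have hcop : IsRelPrime c (bind₁ X P) := by
    intro D hD1 hD2
    -- On a common factor the first alternative fails because it excludes c, and the second because
    -- P(1,1,1) ≠ 0.
    by_contra hu
    obtain ⟨A, hAi, hd⟩ := WfDvdMonoid.exists_irreducible_factor hu (ne_zero_of_dvd_ne_zero hPX hD2)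
    obtain ⟨a, hA⟩ := isHomogeneous_of_dvd hPXh hPX (hd.trans hD2)
    rcases hXY.alt A a hA hAi with h1 | ⟨h1, h2, -⟩
    · exact h1.2 (hd.trans hD1)
    · exact hbeta A hAi h1 h2 (hd.trans hD2)
  have hdvd : ∀ i, bind₁ X P ^ m ∣ bind₁ Y (familyMap P R Q i) := fun i =>
    (hcop.pow (m := p + q) (n := m)).symm.dvd_of_dvd_mul_left ⟨_, hF₂ i⟩
  choose Z hZ using hdvd
  have hZ₂ : ∀ i, c ^ (p + q) * Z i = bind₁ X (F₂ i) := fun i => by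
    apply mul_left_cancel₀ (pow_ne_zero m hPX)
    rw [← hF₂, hZ]; ring
  refine ⟨Z, ⟨y, hy⟩, ⟨y * (p + q) - x * p * m, fun i => ?_⟩, pow_ne_zero _ hPX,
    fun G g hG h0 => ?_, fun i => (hZ i).symm, fun A a hA hAi => ?_⟩
  · refine isHomogeneous_right_of_mul (hPXh.pow m) (pow_ne_zero _ hPX) ?_
    rw [← hZ]
    exact IsHomogeneous.bind₁ (h.homF i) hy
  · have h1 := hcomp G g hG
    rw [h0, mul_zero] at h1
    exact h.eq_zero_of_bind₁_eq_zero
      (hXY.dominant _ _ (IsHomogeneous.bind₁ hG h.homF) h1.symm)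
  · rcases hXY.alt A a hA hAi with ⟨hN, hc⟩ | ⟨h1, h2, h3⟩
    · obtain ⟨B, b, hB, hBi, hgen⟩ := hN.exists_generator hA hAi hx
      have hconst := fun v => GoodPair.constMod_mul hXY.eq_mul hAi hc hgen (v := v)
      -- If X maps the curve onto a component of {P = 0}, then Y is the point [1:1:1] there and Z
      -- behaves like F₂ on that component. Otherwise f does not contract the image, and Y stays
      -- nonconstant.
      by_cases hBP : B ∣ P
      · refine Or.inr ⟨(hconst _).mpr (FamilyHyp.constMod_of_dvd hBP), ?_, fun v hv h4 => ?_⟩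
        · obtain ⟨i, hi⟩ := h.noCommonFactor.exists_not_dvd hBi
          refine ⟨i, fun h4 => hi ?_⟩
          rw [← hgen, ← hXY.eq_mul]
          exact h4.mul_left _
        · exact h.nonConst₂ B b hB hBi hBP v hv
            ((GoodPair.constMod_mul hZ₂ hAi (fun h5 => hc (hAi.prime.dvd_of_dvd_pow h5)) hgen).mp h4)
      · refine Or.inl ⟨fun v hv h4 => hBP (h.dvd_P_of_constMod hB hBi hv ((hconst v).mp h4)),
          fun h4 => hBP ((hgen P).mp (hAi.prime.dvd_of_dvd_pow h4))⟩
    · exact Or.inl ⟨h3, fun h4 => hbeta A hAi h1 h2 (hAi.prime.dvd_of_dvd_pow h4)⟩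

/-- Liftings of all iterates. -/
theorem exists_sequence (h : SecondIterate p q P R Q m F₂) :
    ∃ (Φ : ℕ → PolyMap 2) (c : ℕ → Poly 2), Φ 0 = X ∧ Φ 1 = familyMap P R Q ∧
      (∀ n, c (n + 1) = bind₁ (Φ n) P ^ m) ∧
      ∀ n, GoodPair (familyMap P R Q) (Φ n) (Φ (n + 1)) (c n) := by
  let T := {t : PolyMap 2 × PolyMap 2 × Poly 2 // GoodPair (familyMap P R Q) t.1 t.2.1 t.2.2}
  have hstep : ∀ t : T, ∃ t' : T, t'.1.1 = t.1.2.1 ∧ t'.1.2.2 = bind₁ t.1.1 P ^ m := by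
    rintro ⟨⟨X, Y, c⟩, ht⟩
    obtain ⟨Z, hZ⟩ := h.goodPair_succ ht
    exact ⟨⟨⟨Y, Z, _⟩, hZ⟩, rfl, rfl⟩
  choose next hnext using hstep
  let s : ℕ → T := fun n => n.rec ⟨⟨X, familyMap P R Q, 1⟩, h.goodPair_zero⟩ fun _ t => next t
  have hs : ∀ n, (s (n + 1)).1.1 = (s n).1.2.1 := fun n => (hnext (s n)).1
  refine ⟨fun n => (s n).1.1, fun n => (s n).1.2.2, rfl, hs 0, fun n => (hnext (s n)).2, fun n => ?_⟩
  simp only [hs]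
  exact (s n).2

theorem isIterateLifting_of_goodPair (h : SecondIterate p q P R Q m F₂) {Φ : ℕ → PolyMap 2}
    {c : ℕ → Poly 2} (h0 : Φ 0 = X)
    (hΦ : ∀ n, GoodPair (familyMap P R Q) (Φ n) (Φ (n + 1)) (c n)) (n : ℕ) :
    IsIterateLifting (familyMap P R Q) n (Φ n) := by
  refine ⟨(hΦ n).noCommonFactor, ?_⟩
  induction n with
  | zero => exact ⟨1, one_ne_zero, fun i => by rw [h0, one_mul]; rfl⟩
  | succ n ih =>
    obtain ⟨k, hk, hn⟩ := ih
    refine ⟨k ^ (p + q) * c n, mul_ne_zero (pow_ne_zero _ hk) (hΦ n).c_ne, fun i => ?_⟩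
    change bind₁ (polyIterate (familyMap P R Q) n) (familyMap P R Q i) = _
    rw [funext hn, bind₁_smul (h.homF i), mul_assoc, (hΦ n).eq_mul]

theorem isQAS (h : SecondIterate p q P R Q m F₂) : IsQAS (familyMap P R Q) := by
  obtain ⟨Φ, c, h0, h1, hc, hΦ⟩ := h.exists_sequence
  have hlift := h.isIterateLifting_of_goodPair h0 hΦ
  refine ⟨1, P ^ m, p * m, le_rfl, pow_ne_zero _ h.P_ne_zero, h.homP.pow m, fun Ψ hΨ => ?_⟩
  obtain ⟨u₀, hu₀, hΨ₀⟩ := (hlift 0).eq_C_mul (hΨ 0 zero_le_one)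
  obtain ⟨u₁, hu₁, hΨ₁⟩ := (hlift 1).eq_C_mul (hΨ 1 le_rfl)
  -- Arbitrary initial liftings differ from `Φ 0` and `Φ 1` by constants. The exponents p + q and p
  -- * m, the degrees of F and of P ^ m, say how these constants propagate through the recursion.
  let w : ℕ → ℂ × ℂ := fun n => n.rec (u₀, u₁) fun _ t =>
    (t.2, u₁ * t.2 ^ (p + q) / t.1 ^ (p * m))
  let u : ℕ → ℂ := fun n => (w n).1
  have hrec : ∀ n, u (n + 2) = u₁ * u (n + 1) ^ (p + q) / u n ^ (p * m) := fun n => rfl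
  have hu : ∀ n, u n ≠ 0 ∧ u (n + 1) ≠ 0 := by
    intro n
    induction n with
    | zero => exact ⟨hu₀, hu₁⟩
    | succ n ih =>
      refine ⟨ih.2, ?_⟩
      rw [hrec]
      exact div_ne_zero (mul_ne_zero hu₁ (pow_ne_zero _ ih.2)) (pow_ne_zero _ ih.1)
  refine ⟨fun n i => C (u n) * Φ n i, fun n hn => ?_, fun n => (hlift n).C_mul (hu n).1,
    fun n hn i => ?_⟩
  · interval_cases n
    · exact (funext hΨ₀).symm
    · exact (funext hΨ₁).symm
  · obtain ⟨l, rfl⟩ : ∃ l, n = l + 2 := ⟨n - 2, by omega⟩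
    change C (u (l + 2)) * Φ (l + 2) i * bind₁ (fun i => C (u l) * Φ l i) (P ^ m) =
      bind₁ (fun i => C (u (l + 1)) * Φ (l + 1) i) (C u₁ * Φ 1 i)
    rw [bind₁_smul (h.homP.pow m), map_mul, bind₁_C_right, h1, bind₁_smul (h.homF i),
      ← (hΦ (l + 1)).eq_mul, hc, map_pow]
    have hul : C (u (l + 2)) * C (u l) ^ (p * m) = (C u₁ * C (u (l + 1)) ^ (p + q) : Poly 2) := by
      rw [← C_pow, ← C_mul, ← C_pow, ← C_mul, hrec,
        div_mul_cancel₀ _ (pow_ne_zero _ (hu l).1)]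
    linear_combination (Φ (l + 2) i * bind₁ (Φ l) P ^ m) * hul

end SecondIterate

/-! ### Degree lowering curves and primitive systems -/

namespace FamilyHyp

variable {p q : ℕ} {P R : Poly 2} {Q : Fin 3 → Poly 2}

/-- A curve outside {P = 0} is mapped onto a curve, on which the components of F do not all vanish,
so only components of P could be common factors. Condition 2 thus becomes a statement about F₂. -/
theorem isIterateLifting_two (h : FamilyHyp p q P R Q) {m : ℕ} {F₂ : PolyMap 2}
    (hF₂ : ∀ j, bind₁ (familyMap P R Q) (familyMap P R Q j) = P ^ m * F₂ j)
    (hP : ∀ (A : Poly 2) (a : ℕ), A.IsHomogeneous a → Irreducible A → A ∣ P → ∃ j, ¬ A ∣ F₂ j) :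
    (∃ e, ∀ i, (F₂ i).IsHomogeneous e) ∧ IsIterateLifting (familyMap P R Q) 2 F₂ := by
  have hhom : ∀ i, (F₂ i).IsHomogeneous ((p + q) * (p + q) - p * m) := fun i => by
    refine isHomogeneous_right_of_mul (h.homP.pow m) (pow_ne_zero _ h.P_ne_zero) ?_
    rw [← hF₂]
    exact IsHomogeneous.bind₁ (h.homF i) h.homF
  obtain ⟨A, a, hA, hAi, hd⟩ := h.exists_component
  obtain ⟨j, hj⟩ := hP A a hA hAi hd
  refine ⟨⟨_, hhom⟩, ?_, P ^ m, pow_ne_zero _ h.P_ne_zero, fun i => ?_⟩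
  · refine NoCommonFactor.of_irreducible hhom (fun h0 => hj (h0 ▸ dvd_zero A)) fun A a hA hAi => ?_
    by_cases hd : A ∣ P
    · exact hP A a hA hAi hd
    · obtain ⟨B, -, -, hBi, hgen⟩ :=
        ((h.nonConstMod_iff hA hAi).mpr hd).exists_generator hA hAi h.homF
      by_contra! h1
      obtain ⟨i, hi⟩ := h.noCommonFactor.exists_not_dvd hBi
      apply hi
      rw [← hgen, hF₂]
      exact (h1 i).mul_left _
  · rw [← hF₂]
    change bind₁ (polyIterate (familyMap P R Q) 1) _ = _
    rw [polyIterate_one]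

theorem image_subset_of_subset {V : Set (PSpace 2)}
    (hV : V ⊆ zeroLocus P) : image (familyMap P R Q) V ⊆ {onePoint} := by
  intro x hx
  refine eq_mk_of_forall_mem one_ne_zero' fun i j => hx _ 1
    ((isHomogeneous_C_mul_X _ _).sub (isHomogeneous_C_mul_X _ _)) ?_
  rintro _ ⟨y, hy, hy0, rfl⟩
  rw [mk_mem_zeroLocus (e := 1) ((isHomogeneous_C_mul_X _ _).sub (isHomogeneous_C_mul_X _ _))]
  have hP : eval y.rep P = 0 := hV hy
  simp [evalMap, familyMap, hP]

theorem onePoint_mem_indeterminacy (h : FamilyHyp p q P R Q) :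
    onePoint ∈ indeterminacy (familyMap P R Q) := by
  rw [mem_indeterminacy_iff]
  intro i
  rw [onePoint, mk_mem_zeroLocus (h.homF i)]
  simp [familyMap, h.eval_one]

theorem onePoint_notMem (h : FamilyHyp p q P R Q) : onePoint ∉ zeroLocus P := by
  rw [onePoint, mk_mem_zeroLocus h.homP]
  exact h.evalP

theorem iterImage_one (h : FamilyHyp p q P R Q) (V : Set (PSpace 2)) :
    iterImage (familyMap P R Q) 1 V = image (familyMap P R Q) V :=
  (isIterateLifting_one h.noCommonFactor).iterImage_eq V

theorem image_component (h : FamilyHyp p q P R Q) {A : Poly 2} {a : ℕ} (hA : A.IsHomogeneous a)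
    (hAi : Irreducible A) (hd : A ∣ P) : image (familyMap P R Q) (zeroLocus A) = {onePoint} :=
  (constMod_of_dvd hd).image_eq hA hAi h.homF one_ne_zero' (h.noCommonFactor.exists_not_dvd hAi)

theorem isDegreeLowering_of_subset (h : FamilyHyp p q P R Q) {V : Set (PSpace 2)}
    (hV : IsHypersurface V) (hVP : V ⊆ zeroLocus P) : IsDegreeLowering (familyMap P R Q) V 1 := by
  refine ⟨hV, le_rfl, ?_, fun m h1 h2 => absurd h1 (not_le.mpr h2)⟩
  rw [h.iterImage_one]
  refine (FamilyHyp.image_subset_of_subset hVP).trans ?_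
  rintro _ rfl
  exact h.onePoint_mem_indeterminacy

theorem isHypersurface_zeroLocus_P (h : FamilyHyp p q P R Q) : IsHypersurface (zeroLocus P) :=
  ⟨P, p, h.pos, h.homP, h.P_ne_zero, rfl⟩

theorem not_zeroLocus_subset_indeterminacy (h : FamilyHyp p q P R Q) {B : Poly 2} {b : ℕ}
    (hB : B.IsHomogeneous b) (hBi : Irreducible B) :
    ¬ zeroLocus B ⊆ indeterminacy (familyMap P R Q) := by
  intro h1
  obtain ⟨i, hi⟩ := h.noCommonFactor.exists_not_dvd hBi
  apply hi
  rw [← zeroLocus_subset_zeroLocus_iff hB hBi (h.homF i)]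
  exact fun x hx => mem_indeterminacy_iff.mp (h1 hx) i

/-- A hypersurface whose image contains no curve is contained in `{P = 0}`. -/
theorem subset_zeroLocus_of_codimGtOne (h : FamilyHyp p q P R Q) {V : Set (PSpace 2)}
    (hV : IsHypersurface V) (hc : CodimGtOne (image (familyMap P R Q) V)) : V ⊆ zeroLocus P := by
  obtain ⟨G, g, -, hG, hG0, rfl⟩ := hV
  intro x hx
  obtain ⟨A, a, hA, hAi, hd, hxA⟩ := exists_component_of_mem hG hG0 hx
  refine zeroLocus_mono ?_ hxA
  by_contra hAP
  have hN := (h.nonConstMod_iff hA hAi).mpr hAP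
  obtain ⟨B, b, hB, hBi, hgen⟩ := hN.exists_generator hA hAi h.homF
  refine hc (zeroLocus B) ⟨B, b, hB, hBi, rfl⟩ ?_
  rw [← hN.image_eq hA hAi h.homF hB hgen]
  exact image_mono (zeroLocus_mono hd)

end FamilyHyp

namespace SecondIterate

variable {p q m : ℕ} {P R : Poly 2} {Q : Fin 3 → Poly 2} {F₂ : PolyMap 2}

/-- Irreducible degree lowering curves are mapped onto a component of `{P = 0}`. -/
theorem captures (h : SecondIterate p q P R Q m F₂) {V : Set (PSpace 2)} {n : ℕ}
    (hV : IsIrreducibleHypersurface V) (hn : IsDegreeLowering (familyMap P R Q) V n) :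
    ∃ l < n, IsHypersurface (iterImage (familyMap P R Q) l V) ∧
      iterImage (familyMap P R Q) l V ⊆ zeroLocus P := by
  obtain ⟨Φ, c, h0, h1, hc, hΦ⟩ := h.exists_sequence
  have hlift := h.isIterateLifting_of_goodPair h0 hΦ
  obtain ⟨A, a, hA, hAi, rfl⟩ := hV
  obtain ⟨-, hn1, hsub, -⟩ := hn
  obtain ⟨l, rfl⟩ : ∃ l, n = l + 1 := ⟨n - 1, by omega⟩
  rw [(hlift _).iterImage_eq] at hsub
  -- The indeterminacy locus contains no curve, so a curve reaching it has been contracted.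
  have hnc : ¬ NonConstMod A (Φ (l + 1)) := by
    intro hN
    obtain ⟨e, he⟩ := (hΦ (l + 1)).homX
    obtain ⟨B, b, hB, hBi, hgen⟩ := hN.exists_generator hA hAi he
    rw [hN.image_eq hA hAi he hB hgen] at hsub
    exact h.not_zeroLocus_subset_indeterminacy hB hBi hsub
  have hone := (((hΦ (l + 1)).alt A a hA hAi).resolve_left fun h2 => hnc h2.1).1
  -- One step earlier the image is still a curve, and f contracts this curve.
  obtain ⟨hN, hcl⟩ := ((hΦ l).alt A a hA hAi).resolve_right fun h2 => hnc h2.2.2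
  obtain ⟨e, he⟩ := (hΦ l).homX
  obtain ⟨B, b, hB, hBi, hgen⟩ := hN.exists_generator hA hAi he
  have hBP : B ∣ P := h.dvd_P_of_constMod hB hBi FamilyHyp.one_ne_zero'
    ((GoodPair.constMod_mul (hΦ l).eq_mul hAi hcl hgen).mp hone)
  refine ⟨l, Nat.lt_succ_self l, ?_⟩
  rw [(hlift l).iterImage_eq, hN.image_eq hA hAi he hB hgen]
  exact ⟨isHypersurface_zeroLocus hB hBi, zeroLocus_mono hBP⟩

theorem isPrimitiveSystem_iff (h : SecondIterate p q P R Q m F₂) (S : Set (Set (PSpace 2) × ℕ)) :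
    IsPrimitiveSystem (familyMap P R Q) S ↔ S = {(zeroLocus P, 1)} := by
  constructor
  · intro hS
    have hS1 : ∀ s ∈ S, s.1 ⊆ zeroLocus P ∧ s.2 = 1 := by
      intro s hs
      obtain ⟨hhyp, h1, -, hmin⟩ := hS.degreeLowering s hs
      have hcod := hS.codim s hs 1 le_rfl h1
      rw [h.iterImage_one] at hcod
      have hsub := h.subset_zeroLocus_of_codimGtOne hhyp hcod
      refine ⟨hsub, le_antisymm ?_ h1⟩
      by_contra hlt
      exact hmin 1 le_rfl (not_le.mp hlt) (h.isDegreeLowering_of_subset hhyp hsub).2.2.1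
    -- A component of {P = 0} has height 1, so it can only be captured at time 0, by containment in
    -- a member of S.
    have hcomp : ∀ (A : Poly 2) (a : ℕ), A.IsHomogeneous a → Irreducible A → A ∣ P →
        ∃ s ∈ S, zeroLocus A ⊆ s.1 := by
      intro A a hA hAi hd
      obtain ⟨l, hl, s, hs, -, hsub⟩ := hS.captures (zeroLocus A) 1 ⟨A, a, hA, hAi, rfl⟩
        (h.isDegreeLowering_of_subset (isHypersurface_zeroLocus hA hAi) (zeroLocus_mono hd))
      obtain rfl : l = 0 := by omega
      rw [iterImage_zero hA] at hsub
      exact ⟨s, hs, hsub⟩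
    -- All members have height 1, while distinct members have distinct heights.
    have huniq : ∀ s ∈ S, ∀ t ∈ S, s = t := by
      intro s hs t ht
      by_contra hne
      exact hS.heights_ne s hs t ht hne ((hS1 s hs).2.trans (hS1 t ht).2.symm)
    obtain ⟨A, a, hA, hAi, hd⟩ := h.exists_component
    obtain ⟨s, hs, -⟩ := hcomp A a hA hAi hd
    have hs_eq : s = (zeroLocus P, 1) := by
      refine Prod.ext (Set.Subset.antisymm (hS1 s hs).1 fun x hx => ?_) (hS1 s hs).2
      obtain ⟨B, b, hB, hBi, hBd, hxB⟩ := exists_component_of_mem h.homP h.P_ne_zero hx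
      obtain ⟨t, ht, hsub⟩ := hcomp B b hB hBi hBd
      rw [huniq s hs t ht]
      exact hsub hxB
    rw [← hs_eq]
    exact Set.eq_singleton_iff_unique_mem.mpr ⟨hs, fun t ht => huniq t ht s hs⟩
  · rintro rfl
    refine ⟨Set.finite_singleton _, ?_, ?_, ?_, ?_⟩
    · rintro _ rfl
      exact h.isDegreeLowering_of_subset h.isHypersurface_zeroLocus_P subset_rfl
    · rintro _ rfl _ rfl hne
      exact absurd rfl hne
    · rintro _ rfl l h1 h2
      obtain rfl : l = 1 := le_antisymm h2 h1
      rintro _ ⟨A, a, hA, hAi, rfl⟩ hsub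
      rw [h.iterImage_one] at hsub
      exact not_zeroLocus_subset_singleton hA hAi _
        (hsub.trans (FamilyHyp.image_subset_of_subset subset_rfl))
    · intro V n hV hn
      obtain ⟨l, hl, h1, h2⟩ := h.captures hV hn
      exact ⟨l, hl, _, rfl, h1, h2⟩

end SecondIterate

end QASMap

theorem mainTheorem2
    (p q : ℕ) (P R : QASMap.Poly 2) (Q : Fin 3 → QASMap.Poly 2)
    (hp : 0 < p) (hP : P.IsHomogeneous p) (hQ : ∀ j, (Q j).IsHomogeneous q)
    (hR : R.IsHomogeneous (p + q))
    (hone : ∀ j, MvPolynomial.eval (fun _ => (1 : ℂ)) P * MvPolynomial.eval (fun _ => (1 : ℂ)) (Q j)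
      = MvPolynomial.eval (fun _ => (1 : ℂ)) R)
    (hR1 : MvPolynomial.eval (fun _ => (1 : ℂ)) R ≠ 0)
    (hcop : QASMap.NoCommonFactor (QASMap.familyMap P R Q))
    (h1 : ∀ a : Fin 3 → ℂ, a ≠ 0 → ∑ j, a j = 0 →
      ∀ V, QASMap.IsIrreducibleHypersurface V →
        V ⊆ QASMap.zeroLocus (∑ j, MvPolynomial.C (a j) * Q j) →
          QASMap.IsHypersurface (QASMap.image (QASMap.familyMap P R Q) V))
    (h2 : ∀ V, QASMap.IsIrreducibleHypersurface V → V ⊆ QASMap.zeroLocus P →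
      QASMap.IsHypersurface (QASMap.iterImage (QASMap.familyMap P R Q) 2 V))
    (h3 : ∀ V, QASMap.IsIrreducibleHypersurface V →
      QASMap.image (QASMap.familyMap P R Q) V = {QASMap.onePoint} → V ⊆ QASMap.zeroLocus P) :
    QASMap.IsDominantSelfMap (QASMap.familyMap P R Q) ∧
    QASMap.SatisfiesCriterion (QASMap.familyMap P R Q) (QASMap.zeroLocus P) 1 ∧
    QASMap.IsQAS (QASMap.familyMap P R Q) := by
  have hF : QASMap.FamilyHyp p q P R Q := by
    refine ⟨hp, hP, hQ, hR, hone, hR1, hcop, fun a ha hs A e hA hAi hd => ?_⟩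
    exact QASMap.nonConstMod_of_isHypersurface_image hA hAi (fun j => (hP.mul (hQ j)).sub hR)
      (hcop.exists_not_dvd hAi)
      (h1 a ha hs _ ⟨A, e, hA, hAi, rfl⟩ (QASMap.zeroLocus_mono hd))
  obtain ⟨m, F₂, hF₂, hprim⟩ := hF.exists_second_iterate
  obtain ⟨⟨e, he⟩, hlift⟩ := hF.isIterateLifting_two hF₂ hprim
  have hS : QASMap.SecondIterate p q P R Q m F₂ := by
    refine ⟨hF, hF₂, fun A a hA hAi hd => ?_⟩
    refine QASMap.nonConstMod_of_isHypersurface_image hA hAi he (hprim A a hA hAi hd) ?_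
    rw [← hlift.iterImage_eq]
    exact h2 _ ⟨A, a, hA, hAi, rfl⟩ (QASMap.zeroLocus_mono hd)
  refine ⟨hF.isDominantSelfMap, ⟨hS.isPrimitiveSystem_iff, ?_, fun V hV hVP => Or.inr ?_⟩, hS.isQAS⟩
  · rintro _ ⟨A, a, hA, hAi, rfl⟩ hVP l hl1 hl2 hsub
    obtain rfl : l = 1 := le_antisymm hl2 hl1
    rw [hF.iterImage_one, hF.image_component hA hAi
      ((QASMap.zeroLocus_subset_zeroLocus_iff hA hAi hP).mp hVP)] at hsub
    exact hF.onePoint_notMem (hsub rfl)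
  -- With m₀ = 1 the range 2 ≤ l ≤ 1 is empty, and condition 2 is exactly the remaining claim.
  · exact ⟨1, le_rfl, h2 V hV hVP, fun l hl1 hl2 => by omega⟩
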